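/- Let $\Bbbk$ be a field and let $N\ge 0$ be an integer (the number of red strands, or punctures). Let $Q$ be the quiver with vertices $0,1,\dots,N$, a loop $s_i$ at each vertex $i$, and, for $0\le i<N$, an arrow $p_{i+1}\colon i\to i+1$ and an arrow $q_i\colon i+1\to i$. Composing paths from right to left, let $$A=\Bbbk Q\big/\bigl(\,q_ip_{i+1}=s_i,\quad p_{i+1}q_i=s_{i+1},\quad s_{i+1}p_{i+1}=p_{i+1}s_i,\quad s_iq_i=q_is_{i+1}\quad(0\le i<N)\,\bigr)$$ be the $\mathfrak{sl}_2$, $d=1$ KLRW algebra with $N$ red strands. Let $\mathrm{HH}^n(A)=\mathrm{Ext}^n_{A\otimes_{\Bbbk}A^{\mathrm{op}}}(A,A)$ denote its Hochschild cohomology, i.e. the cohomology of $\mathbf{R}\mathrm{Hom}$ from the diagonal $A$-bimodule to itself. Then, as $\Bbbk$-vector spaces, $$\mathrm{HH}^n(A)\cong\begin{cases}\bigoplus_{\ell\in\mathbb{Z}_{\ge 0}}\Bbbk, & n=0,1,\\[2pt] \Bbbk^{N-1}, & n=2 \text{ (for } N\ge 1),\\[2pt] 0, & n\ge 3.\end{cases}$$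 -/

import Mathlib

open scoped TensorProduct

universe u

noncomputable section

namespace KLRW

/-- The generators of the path algebra of the quiver with vertices `0, …, N`, a loop `s i` at every
vertex `i`, and, for `i = 0, …, N - 1`, an arrow `p i : i ⟶ i + 1` and an arrow `q i : i + 1 ⟶ i`.
The generator `e i` is the trivial path at `i`. -/
inductive Gen (N : ℕ) : Type
  | e (i : Fin (N + 1))
  | s (i : Fin (N + 1))
  | p (i : Fin N)
  | q (i : Fin N)

variable (k : Type u) [Field k] (N : ℕ)

/-- A generator as an element of the free algebra. -/
abbrev gen {N : ℕ} (g : Gen N) : FreeAlgebra k (Gen N) := FreeAlgebra.ι k g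

/-- The defining relations. Paths are composed from right to left, so an arrow `x : i ⟶ j`
satisfies `e j * x = x = x * e i`. For `i : Fin N`, the vertices `i.castSucc` and `i.succ` are the
vertices to the left and to the right of the `i`-th red strand. The first nine constructors present
the path algebra of the quiver; the last four are the KLRW relations. -/
inductive Rel : FreeAlgebra k (Gen N) → FreeAlgebra k (Gen N) → Prop
  | e_mul_self (i : Fin (N + 1)) : Rel (gen k (.e i) * gen k (.e i)) (gen k (.e i))
  | e_mul_ne (i j : Fin (N + 1)) (h : i ≠ j) : Rel (gen k (.e i) * gen k (.e j)) 0
  | sum_e : Rel (∑ i : Fin (N + 1), gen k (.e i)) 1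
  | s_target (i : Fin (N + 1)) : Rel (gen k (.e i) * gen k (.s i)) (gen k (.s i))
  | s_source (i : Fin (N + 1)) : Rel (gen k (.s i) * gen k (.e i)) (gen k (.s i))
  | p_target (i : Fin N) : Rel (gen k (.e i.succ) * gen k (.p i)) (gen k (.p i))
  | p_source (i : Fin N) : Rel (gen k (.p i) * gen k (.e i.castSucc)) (gen k (.p i))
  | q_target (i : Fin N) : Rel (gen k (.e i.castSucc) * gen k (.q i)) (gen k (.q i))
  | q_source (i : Fin N) : Rel (gen k (.q i) * gen k (.e i.succ)) (gen k (.q i))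
  | q_mul_p (i : Fin N) : Rel (gen k (.q i) * gen k (.p i)) (gen k (.s i.castSucc))
  | p_mul_q (i : Fin N) : Rel (gen k (.p i) * gen k (.q i)) (gen k (.s i.succ))
  | s_mul_p (i : Fin N) :
      Rel (gen k (.s i.succ) * gen k (.p i)) (gen k (.p i) * gen k (.s i.castSucc))
  | s_mul_q (i : Fin N) :
      Rel (gen k (.s i.castSucc) * gen k (.q i)) (gen k (.q i) * gen k (.s i.succ))

/-- The `𝔰𝔩₂`, `d = 1` KLRW algebra with `N` red strands, over the field `k`: the path algebra
of the above quiver modulo the KLRW relations. -/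
abbrev Alg : Type u := RingQuot (Rel k N)

end KLRW

section Hochschild

variable (k A : Type u) [Field k] [Ring A] [Algebra k A]

/-- The diagonal bimodule of the `k`-algebra `A`: the `A ⊗[k] Aᵐᵒᵖ`-module `A` with
`(a ⊗ op b) • x = a * x * b`. -/
def diagonalBimodule : ModuleCat.{u} (A ⊗[k] Aᵐᵒᵖ) :=
  letI : Module (A ⊗[k] Aᵐᵒᵖ) A := TensorProduct.Algebra.module
  ModuleCat.of (A ⊗[k] Aᵐᵒᵖ) A

/-- The Hochschild cohomology `HHⁿ(A) = Extⁿ(A, A)` of a `k`-algebra, in the category of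
`A`-bimodules over the field `k`. -/
abbrev HochschildCohomology (n : ℕ) : Type u :=
  CategoryTheory.Abelian.Ext.{u} (diagonalBimodule k A) (diagonalBimodule k A) n

end Hochschild

end

/-!
Let `z` be the sum of all loops. It is central, and a representation by matrices over `k[X]` shows
that `e i * A * e j` is free of rank one over `k[z]`, with the shortest path from `j` to `i` as a
basis; in particular, multiplication by `z` is injective.

The loops at the vertices other than `0` are composites `p q`, so `A` is generated over its vertices
by all `p`, all `q` and the loop at `0`, subject only to the relations `q p = s`: that `s` commutes
with `p` and `q` is then associativity of `p q p` and `q p q`. The diagonal bimodule is resolved by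
the free bimodules on vertices, arrows and relations,
`0 → P₂ → P₁ → P₀ → A → 0`. Exactness at `P₁` says that a derivation is given by values at the
arrows that respect the relations. The coefficients of a cycle in `P₂` vanish one vertex after the
other: the coefficient at a relation is determined, up to multiplication by `z`, by its
predecessor.

Homomorphisms into `A` turn the resolution into a complex of families of polynomials
`k[X]^(N + 1) → k[X]^(2 N + 1) → k[X]^N`. Its cohomology consists of the constant families, of the
multiples of one derivation, and, in degree two, of the constant coefficients at all relations but
the first: the loop at `0` makes the first relation a coboundary, and the other components of
coboundaries are divisible by `X`.
-/

noncomputable section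

section Ext

open CategoryTheory CategoryTheory.Abelian

section ProjectiveResolution

universe w v v'

variable {k : Type*} [CommRing k] {C : Type v} [Category.{v'} C] [Abelian C] [Linear k C]
  [HasExt.{w} C] {X : C} (R : ProjectiveResolution X) (Y : C)

variable (k) in
/-- The map that sends an `n`-cocycle of `Hom(R, Y)`, for a projective resolution `R` of `X`, to
its class in `Ext X Y n`. -/
def extOfCocycle (n : ℕ) :
    LinearMap.ker (Linear.leftComp k Y (R.complex.d (n + 1) n)) →ₗ[k] Ext X Y n where
  toFun f := R.extMk f.1 (n + 1) rfl f.2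
  map_add' f g := (R.add_extMk f.1 g.1 (n + 1) rfl f.2 g.2).symm
  map_smul' r f := by
    refine Eq.trans ?_ (Ext.smul_eq_comp_mk₀ _ r).symm
    refine Eq.trans ?_ (R.extMk_comp_mk₀ f.1 (n + 1) rfl f.2 (r • 𝟙 Y)).symm
    congr 1
    simp

lemma extOfCocycle_surjective (n : ℕ) : Function.Surjective (extOfCocycle k R Y n) := by
  intro x
  obtain ⟨f, hf, rfl⟩ := R.extMk_surjective x (n + 1) rfl
  exact ⟨⟨f, hf⟩, rfl⟩

lemma extOfCocycle_succ_eq_zero_iff (n : ℕ)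
    (f : LinearMap.ker (Linear.leftComp k Y (R.complex.d (n + 2) (n + 1)))) :
    extOfCocycle k R Y (n + 1) f = 0 ↔ ∃ g, R.complex.d (n + 1) n ≫ g = f.1 :=
  R.extMk_eq_zero_iff f.1 (n + 2) rfl f.2 n rfl

variable {R Y} {n : ℕ} {C₀ C₁ C₂ : Type*} [AddCommGroup C₀] [Module k C₀] [AddCommGroup C₁]
  [Module k C₁] [AddCommGroup C₂] [Module k C₂] {δ₀ : C₀ →ₗ[k] C₁} {δ₁ : C₁ →ₗ[k] C₂}

/-- `Ext X Y (n + 1)` computed by three modules that are identified with three consecutive terms of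
`Hom(R, Y)`, for a projective resolution `R` of `X`. -/
def extSuccEquiv (e₀ : C₀ ≃ₗ[k] (R.complex.X n ⟶ Y)) (e₁ : C₁ ≃ₗ[k] (R.complex.X (n + 1) ⟶ Y))
    (e₂ : C₂ ≃ₗ[k] (R.complex.X (n + 2) ⟶ Y))
    (h₀ : ∀ c, e₁ (δ₀ c) = R.complex.d (n + 1) n ≫ e₀ c)
    (h₁ : ∀ c, e₂ (δ₁ c) = R.complex.d (n + 2) (n + 1) ≫ e₁ c) :
    Ext X Y (n + 1) ≃ₗ[k] LinearMap.ker δ₁ ⧸ (LinearMap.range δ₀).submoduleOf (LinearMap.ker δ₁) :=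
  have he₁ : LinearMap.ker (Linear.leftComp k Y (R.complex.d (n + 2) (n + 1))) =
      (LinearMap.ker δ₁).map e₁.toLinearMap := by
    ext f
    obtain ⟨c, rfl⟩ := e₁.surjective f
    simp [← h₁]
  let e := (e₁.submoduleMap (LinearMap.ker δ₁)).trans (LinearEquiv.ofEq _ _ he₁.symm)
  have hker : LinearMap.ker (extOfCocycle k R Y (n + 1) ∘ₗ e.toLinearMap) =
      (LinearMap.range δ₀).submoduleOf (LinearMap.ker δ₁) := by
    ext c
    refine (extOfCocycle_succ_eq_zero_iff R Y n (e c)).trans (e₀.surjective.exists.trans ?_)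
    exact exists_congr fun b ↦ by rw [← h₀]; exact e₁.injective.eq_iff
  ((Submodule.quotEquivOfEq _ _ hker).symm.trans (LinearMap.quotKerEquivOfSurjective _
    ((extOfCocycle_surjective R Y (n + 1)).comp e.surjective))).symm

end ProjectiveResolution

/-- A resolution `0 → P₂ → P₁ → P₀ → M → 0` of a module. -/
structure ShortResolution (Λ M P₀ P₁ P₂ : Type*) [Ring Λ] [AddCommGroup M] [Module Λ M]
    [AddCommGroup P₀] [Module Λ P₀] [AddCommGroup P₁] [Module Λ P₁] [AddCommGroup P₂]
    [Module Λ P₂] where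
  ε : P₀ →ₗ[Λ] M
  d₁ : P₁ →ₗ[Λ] P₀
  d₂ : P₂ →ₗ[Λ] P₁
  ε_surjective : Function.Surjective ε
  exact_d₁_ε : Function.Exact d₁ ε
  exact_d₂_d₁ : Function.Exact d₂ d₁
  d₂_injective : Function.Injective d₂

namespace ShortResolution

variable {Λ M P₀ P₁ P₂ : Type u} [Ring Λ] [AddCommGroup M] [Module Λ M] [AddCommGroup P₀]
  [Module Λ P₀] [AddCommGroup P₁] [Module Λ P₁] [AddCommGroup P₂] [Module Λ P₂]
  (R : ShortResolution Λ M P₀ P₁ P₂)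

variable (Λ P₀ P₁ P₂) in
/-- The terms of the chain complex `⋯ → 0 → 0 → P₂ → P₁ → P₀`. -/
def term : ℕ → ModuleCat.{u} Λ
  | 0 => .of Λ P₀
  | 1 => .of Λ P₁
  | 2 => .of Λ P₂
  | _ + 3 => .of Λ PUnit

/-- The differentials of the chain complex `⋯ → 0 → 0 → P₂ → P₁ → P₀`. -/
def differential : ∀ n, term Λ P₀ P₁ P₂ (n + 1) ⟶ term Λ P₀ P₁ P₂ n
  | 0 => ModuleCat.ofHom R.d₁
  | 1 => ModuleCat.ofHom R.d₂
  | _ + 2 => 0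

lemma differential_exact : ∀ n, Function.Exact (R.differential (n + 1)).hom (R.differential n).hom
  | 0 => R.exact_d₂_d₁
  | 1 => fun _ ↦ (map_eq_zero_iff _ R.d₂_injective).trans
      ⟨fun h ↦ ⟨0, h.symm⟩, fun ⟨_, h⟩ ↦ h.symm⟩
  | _ + 2 => fun _ ↦ ⟨fun _ ↦ ⟨0, rfl⟩, fun _ ↦ rfl⟩

lemma differential_comp (n : ℕ) : R.differential (n + 1) ≫ R.differential n = 0 :=
  ModuleCat.hom_ext (R.differential_exact n).linearMap_comp_eq_zero

/-- The chain complex `⋯ → 0 → 0 → P₂ → P₁ → P₀`. -/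
def complex : ChainComplex (ModuleCat.{u} Λ) ℕ :=
  .of (term Λ P₀ P₁ P₂) R.differential R.differential_comp

lemma complex_d (n : ℕ) : R.complex.d (n + 1) n = R.differential n := ChainComplex.of_d ..

/-- The augmentation as a morphism to the complex `M`, concentrated in degree zero. -/
def augmentation : R.complex ⟶ (ChainComplex.single₀ (ModuleCat.{u} Λ)).obj (.of Λ M) :=
  (R.complex.toSingle₀Equiv _).symm ⟨ModuleCat.ofHom R.ε, by
    rw [complex_d]
    exact ModuleCat.hom_ext R.exact_d₁_ε.linearMap_comp_eq_zero⟩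

lemma augmentation_f_zero : R.augmentation.f 0 = ModuleCat.ofHom R.ε :=
  ChainComplex.toSingle₀Equiv_symm_apply_f_zero _ _

lemma quasiIsoAt_augmentation_zero : QuasiIsoAt R.augmentation 0 := by
  rw [ChainComplex.quasiIsoAt₀_iff, ShortComplex.quasiIso_iff_of_zeros']
  · refine ⟨(ShortComplex.ShortExact.moduleCat_exact_iff_function_exact _).2 ?_,
      (ModuleCat.epi_iff_surjective _).2 ?_⟩
    · change Function.Exact (R.complex.d 1 0).hom (R.augmentation.f 0).hom
      rw [complex_d, augmentation_f_zero]
      exact R.exact_d₁_ε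
    · change Function.Surjective (R.augmentation.f 0).hom
      rw [augmentation_f_zero]
      exact R.ε_surjective
  all_goals rfl

lemma quasiIsoAt_augmentation_succ (n : ℕ) : QuasiIsoAt R.augmentation (n + 1) := by
  rw [quasiIsoAt_iff_exactAt' (hL := ChainComplex.exactAt_succ_single_obj ..),
    HomologicalComplex.exactAt_iff' _ (n + 2) (n + 1) n (by simp) (by simp),
    ShortComplex.ShortExact.moduleCat_exact_iff_function_exact]
  change Function.Exact (R.complex.d _ _).hom (R.complex.d _ _).hom
  rw [complex_d, complex_d]
  exact R.differential_exact n

variable [Module.Projective Λ P₀] [Module.Projective Λ P₁] [Module.Projective Λ P₂]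

instance projective_term (n : ℕ) : Projective (term Λ P₀ P₁ P₂ n) := by
  match n with
  | 0 => exact (IsProjective.iff_projective P₀).1 inferInstance
  | 1 => exact (IsProjective.iff_projective P₁).1 inferInstance
  | 2 => exact (IsProjective.iff_projective P₂).1 inferInstance
  | _ + 3 => exact (IsProjective.iff_projective PUnit).1 inferInstance

/-- A short resolution by projective modules as a projective resolution in the category of
modules. -/
def toProjectiveResolution : ProjectiveResolution (ModuleCat.of Λ M) where
  complex := R.complex
  projective := projective_term
  π := R.augmentation
  quasiIso := ⟨fun n ↦ n.casesOn R.quasiIsoAt_augmentation_zero R.quasiIsoAt_augmentation_succ⟩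

include R in
lemma subsingleton_ext (Y : ModuleCat.{u} Λ) {n : ℕ} (hn : 3 ≤ n) :
    Subsingleton (Ext.{u} (ModuleCat.of Λ M) Y n) := by
  obtain ⟨n, rfl⟩ := Nat.exists_eq_add_of_le' hn
  have : Subsingleton (R.toProjectiveResolution.complex.X (n + 3) ⟶ Y) :=
    ⟨(ModuleCat.isZero_of_subsingleton (ModuleCat.of Λ PUnit)).eq_of_src⟩
  exact (extOfCocycle_surjective (k := ℤ) R.toProjectiveResolution Y (n + 3)).subsingleton

end ShortResolution

variable {k : Type*} {Λ M P₀ P₁ P₂ Y : Type u} [Field k] [Ring Λ] [Algebra k Λ] [AddCommGroup M]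
  [Module Λ M] [AddCommGroup P₀] [Module Λ P₀] [AddCommGroup P₁] [Module Λ P₁] [AddCommGroup P₂]
  [Module Λ P₂] [AddCommGroup Y] [Module Λ Y] [Module k Y] [IsScalarTower k Λ Y]

variable (k Λ P₀ Y) in
/-- Linear maps as morphisms of the category of modules. The action of `k` on the morphisms is the
one that comes from the `k`-linear structure of the category. -/
def moduleCatHomEquiv :
    letI : Module k (ModuleCat.of Λ P₀ ⟶ ModuleCat.of Λ Y) := Linear.homModule _ _
    (P₀ →ₗ[Λ] Y) ≃ₗ[k] (ModuleCat.of Λ P₀ ⟶ ModuleCat.of Λ Y) :=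
  letI : Module k (ModuleCat.of Λ P₀ ⟶ ModuleCat.of Λ Y) := Linear.homModule _ _
  { toFun f := ModuleCat.ofHom f
    invFun f := f.hom
    map_add' _ _ := rfl
    map_smul' c f := ModuleCat.hom_ext (LinearMap.ext fun x ↦ (algebraMap_smul Λ c (f x)).symm) }

/-- `k`-linear maps `C₀ → C₁ → C₂` identified with the complex `Hom(P₀, Y) → Hom(P₁, Y) →
Hom(P₂, Y)` of a short resolution. -/
structure CochainModel (k : Type*) {Λ M P₀ P₁ P₂ : Type u} [Field k] [Ring Λ] [Algebra k Λ]
    [AddCommGroup M] [Module Λ M] [AddCommGroup P₀] [Module Λ P₀] [AddCommGroup P₁] [Module Λ P₁]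
    [AddCommGroup P₂] [Module Λ P₂] (R : ShortResolution Λ M P₀ P₁ P₂) (Y : Type u)
    [AddCommGroup Y] [Module Λ Y] [Module k Y] [IsScalarTower k Λ Y]
    (C₀ C₁ C₂ : Type*) [AddCommGroup C₀] [Module k C₀] [AddCommGroup C₁] [Module k C₁]
    [AddCommGroup C₂] [Module k C₂] where
  δ₀ : C₀ →ₗ[k] C₁
  δ₁ : C₁ →ₗ[k] C₂
  equiv₀ : C₀ ≃ₗ[k] (P₀ →ₗ[Λ] Y)
  equiv₁ : C₁ ≃ₗ[k] (P₁ →ₗ[Λ] Y)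
  equiv₂ : C₂ ≃ₗ[k] (P₂ →ₗ[Λ] Y)
  equiv₁_δ₀ : ∀ c, equiv₁ (δ₀ c) = equiv₀ c ∘ₗ R.d₁
  equiv₂_δ₁ : ∀ c, equiv₂ (δ₁ c) = equiv₁ c ∘ₗ R.d₂

namespace CochainModel

variable {R : ShortResolution Λ M P₀ P₁ P₂} {C₀ C₁ C₂ : Type*} [AddCommGroup C₀] [Module k C₀]
  [AddCommGroup C₁] [Module k C₁] [AddCommGroup C₂] [Module k C₂]
  (S : CochainModel k R Y C₀ C₁ C₂)

lemma exists_comp_ε_eq {c : C₀} (hc : S.δ₀ c = 0) : ∃ f : M →ₗ[Λ] Y, f ∘ₗ R.ε = S.equiv₀ c := by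
  have h : LinearMap.ker R.ε ≤ LinearMap.ker (S.equiv₀ c) := by
    rw [LinearMap.exact_iff.1 R.exact_d₁_ε, LinearMap.range_le_ker_iff, ← S.equiv₁_δ₀, hc, map_zero]
  refine ⟨(LinearMap.ker R.ε).liftQ (S.equiv₀ c) h ∘ₗ
    (R.ε.quotKerEquivOfSurjective R.ε_surjective).symm.toLinearMap, LinearMap.ext fun x ↦ ?_⟩
  have hx : (R.ε.quotKerEquivOfSurjective R.ε_surjective).symm (R.ε x) =
      (LinearMap.ker R.ε).mkQ x := by
    rw [LinearEquiv.symm_apply_eq]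
    rfl
  simp [hx]

/-- The linear maps from the resolved module as the cocycles of degree zero. -/
def homEquiv : (M →ₗ[Λ] Y) ≃ₗ[k] LinearMap.ker S.δ₀ :=
  LinearEquiv.ofBijective
    ((S.equiv₀.symm.toLinearMap ∘ₗ LinearMap.lcomp k Y R.ε).codRestrict (LinearMap.ker S.δ₀)
      fun f ↦ S.equiv₁.injective <| by
        simp [S.equiv₁_δ₀, LinearMap.lcomp_apply', LinearMap.comp_assoc,
          R.exact_d₁_ε.linearMap_comp_eq_zero])
    ⟨fun f g h ↦ LinearMap.lcomp_injective_of_surjective R.ε R.ε_surjective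
        (S.equiv₀.symm.injective (congrArg Subtype.val h)),
      fun ⟨c, hc⟩ ↦ (S.exists_comp_ε_eq hc).imp fun f hf ↦
        Subtype.ext (S.equiv₀.symm_apply_eq.2 hf)⟩

/-- `Ext⁰` as the cocycles of degree zero. -/
def extZeroEquiv : Ext.{u} (ModuleCat.of Λ M) (ModuleCat.of Λ Y) 0 ≃ₗ[k] LinearMap.ker S.δ₀ :=
  Ext.linearEquiv₀.trans ((moduleCatHomEquiv k Λ M Y).symm.trans S.homEquiv)

variable [Module.Projective Λ P₀] [Module.Projective Λ P₁] [Module.Projective Λ P₂]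

/-- `Ext¹` as the first cohomology of a model of the complex of homomorphisms. -/
def extOneEquiv : Ext.{u} (ModuleCat.of Λ M) (ModuleCat.of Λ Y) 1 ≃ₗ[k]
    LinearMap.ker S.δ₁ ⧸ (LinearMap.range S.δ₀).submoduleOf (LinearMap.ker S.δ₁) :=
  extSuccEquiv (R := R.toProjectiveResolution) (n := 0)
    (S.equiv₀.trans (moduleCatHomEquiv k Λ P₀ Y)) (S.equiv₁.trans (moduleCatHomEquiv k Λ P₁ Y))
    (S.equiv₂.trans (moduleCatHomEquiv k Λ P₂ Y))
    (fun c ↦ (congrArg ModuleCat.ofHom (S.equiv₁_δ₀ c)).trans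
      (congrArg (· ≫ _) (R.complex_d 0)).symm)
    (fun c ↦ (congrArg ModuleCat.ofHom (S.equiv₂_δ₁ c)).trans
      (congrArg (· ≫ _) (R.complex_d 1)).symm)

/-- `Ext²` as the second cohomology of a model of the complex of homomorphisms. -/
def extTwoEquiv : Ext.{u} (ModuleCat.of Λ M) (ModuleCat.of Λ Y) 2 ≃ₗ[k]
    C₂ ⧸ LinearMap.range S.δ₁ :=
  (extSuccEquiv (R := R.toProjectiveResolution) (n := 1) (δ₁ := (0 : C₂ →ₗ[k] PUnit))
    (S.equiv₁.trans (moduleCatHomEquiv k Λ P₁ Y)) (S.equiv₂.trans (moduleCatHomEquiv k Λ P₂ Y))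
    ((0 : PUnit ≃ₗ[k] (PUnit.{u + 1} →ₗ[Λ] Y)).trans (moduleCatHomEquiv k Λ PUnit Y))
    (fun c ↦ (congrArg ModuleCat.ofHom (S.equiv₂_δ₁ c)).trans
      (congrArg (· ≫ _) (R.complex_d 1)).symm)
    fun _ ↦ (ModuleCat.isZero_of_subsingleton (ModuleCat.of Λ PUnit)).eq_of_src _ _).trans
  (Submodule.Quotient.equiv _ _ ((LinearEquiv.ofEq _ _ LinearMap.ker_zero).trans
    Submodule.topEquiv) (by
      ext c
      simp [Submodule.submoduleOf]))

end CochainModel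

end Ext

section IdemModule

variable {Λ : Type*} [Ring Λ] {ι : Type*} (ε : ι → Λ)

/-- The direct sum of the left ideals `Λ * ε i`, as a submodule of a free module. -/
def idemSubmodule : Submodule Λ (ι → Λ) where
  carrier := {u | ∀ i, u i * ε i = u i}
  zero_mem' := by simp
  add_mem' hu hv i := by simp [add_mul, hu i, hv i]
  smul_mem' c u hu i := by simp [mul_assoc, hu i]

/-- The direct sum of the left ideals `Λ * ε i`. It is meant for finite families of idempotents,
when it is projective and represents the functor that sends a module `M` to the product of the
groups of fixed points of `ε i` on `M`. -/
def IdemModule : Type _ := idemSubmodule ε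

instance : AddCommGroup (IdemModule ε) := inferInstanceAs (AddCommGroup (idemSubmodule ε))

instance : Module Λ (IdemModule ε) := inferInstanceAs (Module Λ (idemSubmodule ε))

namespace IdemModule

variable {ε}

/-- The coefficients of an element of the direct sum of the left ideals `Λ * ε i`. -/
def coeff : IdemModule ε →ₗ[Λ] ι → Λ := (idemSubmodule ε).subtype

lemma coeff_mul (u : IdemModule ε) (i : ι) : coeff u i * ε i = coeff u i := u.2 i

@[ext] lemma ext {u v : IdemModule ε} (h : ∀ i, coeff u i = coeff v i) : u = v :=
  Subtype.ext (funext h)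

variable {M : Type*} [AddCommGroup M] [Module Λ M]

section lift

variable [Fintype ι]

variable (ε) in
/-- The linear map given by a family of elements of `M`. Only the multiples `ε i • m i` matter. -/
def lift (m : ι → M) : IdemModule ε →ₗ[Λ] M where
  toFun u := ∑ i, coeff u i • m i
  map_add' u v := by simp [add_smul, Finset.sum_add_distrib]
  map_smul' c u := by simp [mul_smul, Finset.smul_sum]

lemma lift_apply (m : ι → M) (u : IdemModule ε) : lift ε m u = ∑ i, coeff u i • m i := rfl

end lift

lemma projective [Finite ι] (hε : ∀ i, IsIdempotentElem (ε i)) :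
    Module.Projective Λ (IdemModule ε) :=
  Module.Projective.of_split (M := ι → Λ) coeff
    { toFun u := ⟨fun i ↦ u i * ε i, fun i ↦ by rw [mul_assoc, hε i]⟩
      map_add' u v := Subtype.ext (funext fun i ↦ add_mul (u i) (v i) (ε i))
      map_smul' c u := Subtype.ext (funext fun i ↦ mul_assoc c (u i) (ε i)) }
    (LinearMap.ext fun u ↦ ext (coeff_mul u))

variable (hε : ∀ i, IsIdempotentElem (ε i))

open scoped Classical in
/-- The idempotent `ε i`, as an element of the `i`-th summand. -/
def gen (i : ι) : IdemModule ε :=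
  ⟨Pi.single i (ε i), fun j ↦ by
    rcases eq_or_ne j i with rfl | h
    · simp [(hε _).eq]
    · simp [h]⟩

open scoped Classical in
lemma coeff_gen_self (i : ι) : coeff (gen hε i) i = ε i :=
  Pi.single_eq_same (M := fun _ ↦ Λ) i (ε i)

open scoped Classical in
lemma coeff_gen_of_ne {i j : ι} (h : j ≠ i) : coeff (gen hε i) j = 0 :=
  Pi.single_eq_of_ne (M := fun _ ↦ Λ) h (ε i)

lemma smul_gen (i : ι) : ε i • gen hε i = gen hε i := by
  ext j
  rw [map_smul, Pi.smul_apply]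
  rcases eq_or_ne j i with rfl | h
  · rw [coeff_gen_self, smul_eq_mul, hε j]
  · rw [coeff_gen_of_ne hε h, smul_zero]

section Fintype

variable [Fintype ι]

lemma lift_gen (m : ι → M) (i : ι) : lift ε m (gen hε i) = ε i • m i := by
  rw [lift_apply, Fintype.sum_eq_single i fun j h ↦ by rw [coeff_gen_of_ne hε h, zero_smul],
    coeff_gen_self]

lemma sum_coeff_smul_gen (u : IdemModule ε) : ∑ i, coeff u i • gen hε i = u := by
  ext j
  simp only [map_sum, map_smul, Finset.sum_apply, Pi.smul_apply]
  rw [Fintype.sum_eq_single j fun i h ↦ by rw [coeff_gen_of_ne hε h.symm, smul_zero],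
    coeff_gen_self, smul_eq_mul, coeff_mul]

end Fintype

lemma induction [Finite ι] {p : IdemModule ε → Prop} (u : IdemModule ε) (zero : p 0)
    (smul_gen : ∀ (x : Λ) i, p (x • gen hε i)) (add : ∀ u v, p u → p v → p (u + v)) : p u := by
  cases nonempty_fintype ι
  rw [← sum_coeff_smul_gen hε u]
  exact Finset.sum_induction _ p add zero fun i _ ↦ smul_gen _ i

lemma hom_ext [Finite ι] {f g : IdemModule ε →ₗ[Λ] M} (h : ∀ i, f (gen hε i) = g (gen hε i)) :
    f = g := by
  ext u
  induction u using IdemModule.induction hε with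
  | zero => rw [map_zero, map_zero]
  | smul_gen x i => rw [map_smul, map_smul, h]
  | add u v hu hv => rw [map_add, map_add, hu, hv]

end IdemModule

/-- The elements that `x` fixes. -/
def fixedSubmodule (k : Type*) [Semiring k] {Λ : Type*} [Ring Λ] (x : Λ) (M : Type*)
    [AddCommGroup M] [Module Λ M] [Module k M] [SMulCommClass Λ k M] : Submodule k M where
  carrier := {m | x • m = m}
  zero_mem' := smul_zero x
  add_mem' {m n} (hm : x • m = m) (hn : x • n = n) :=
    show x • (m + n) = m + n by rw [smul_add, hm, hn]
  smul_mem' c m (hm : x • m = m) := show x • c • m = c • m by rw [smul_comm, hm]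

/-- The universal property of the direct sum of the left ideals `Λ * ε i`. -/
def IdemModule.homEquiv (k : Type*) [Semiring k] {ε : ι → Λ} (hε : ∀ i, IsIdempotentElem (ε i))
    [Fintype ι] (M : Type*) [AddCommGroup M] [Module Λ M] [Module k M]
    [SMulCommClass Λ k M] :
    (∀ i, fixedSubmodule k (ε i) M) ≃ₗ[k] (IdemModule ε →ₗ[Λ] M) where
  toFun m := IdemModule.lift ε fun i ↦ (m i).1
  map_add' m n := IdemModule.hom_ext hε fun i ↦ by simp [IdemModule.lift_gen]
  map_smul' c m := IdemModule.hom_ext hε fun i ↦ by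
    simp [IdemModule.lift_gen, smul_comm]
  invFun f i := ⟨f (IdemModule.gen hε i), by
    change ε i • f (IdemModule.gen hε i) = f (IdemModule.gen hε i)
    rw [← map_smul, IdemModule.smul_gen]⟩
  left_inv m := funext fun i ↦ Subtype.ext ((IdemModule.lift_gen hε _ i).trans (m i).2)
  right_inv f := IdemModule.hom_ext hε fun i ↦ by
    rw [IdemModule.lift_gen, ← map_smul, IdemModule.smul_gen]

lemma IdemModule.homEquiv_apply_gen (k : Type*) [Semiring k] {ε : ι → Λ}
    (hε : ∀ i, IsIdempotentElem (ε i)) [Fintype ι] {M : Type*} [AddCommGroup M]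
    [Module Λ M] [Module k M] [SMulCommClass Λ k M] (m : ∀ i, fixedSubmodule k (ε i) M) (i : ι) :
    IdemModule.homEquiv k hε M m (IdemModule.gen hε i) = (m i).1 :=
  (IdemModule.lift_gen hε _ i).trans (m i).2

end IdemModule

section Bimodule

open MulOpposite

/-- The enveloping algebra `A ⊗ Aᵐᵒᵖ`. It is a definition in order to keep the search for
instances away from the tensor product. -/
def Env (k A : Type*) [CommRing k] [Ring A] [Algebra k A] := A ⊗[k] Aᵐᵒᵖ

variable {k A : Type*} [CommRing k] [Ring A] [Algebra k A]

instance : Ring (Env k A) := inferInstanceAs (Ring (A ⊗[k] Aᵐᵒᵖ))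

instance : Algebra k (Env k A) := inferInstanceAs (Algebra k (A ⊗[k] Aᵐᵒᵖ))

variable (k) in
/-- The element `a ⊗ b` of the enveloping algebra. It acts on a bimodule by `m ↦ a * m * b`. -/
def ten (a b : A) : Env k A := (a ⊗ₜ op b : A ⊗[k] Aᵐᵒᵖ)

lemma ten_mul_ten (a b c d : A) : ten k a b * ten k c d = ten k (a * c) (d * b) :=
  Algebra.TensorProduct.tmul_mul_tmul a c (op b) (op d)

lemma ten_induction {p : Env k A → Prop} (x : Env k A) (zero : p 0)
    (ten : ∀ a b, p (ten k a b)) (add : ∀ x y, p x → p y → p (x + y)) : p x :=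
  TensorProduct.induction_on (motive := p) x zero (fun a b ↦ ten a (unop b)) add

variable (k A) in
/-- The bilinear map `(a, b) ↦ a ⊗ b`. -/
def tenHom : A →ₗ[k] A →ₗ[k] Env k A :=
  (TensorProduct.mk k A Aᵐᵒᵖ).compl₂ (opLinearEquiv k).toLinearMap

lemma ten_add_left (a b c : A) : ten k (a + b) c = ten k a c + ten k b c :=
  (tenHom k A).map_add₂ a b c

lemma ten_add_right (a b c : A) : ten k a (b + c) = ten k a b + ten k a c :=
  (tenHom k A a).map_add b c

lemma ten_smul_left (r : k) (a b : A) : ten k (r • a) b = r • ten k a b :=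
  (tenHom k A).map_smul₂ r a b

lemma ten_smul_right (r : k) (a b : A) : ten k a (r • b) = r • ten k a b :=
  (tenHom k A a).map_smul r b

@[simp] lemma ten_zero_left (a : A) : ten k 0 a = 0 := (tenHom k A).map_zero₂ a

@[simp] lemma ten_zero_right (a : A) : ten k a 0 = 0 := (tenHom k A a).map_zero

lemma exists_env_lift {Q : Type*} [AddCommGroup Q] [Module k Q] (B : A →ₗ[k] A →ₗ[k] Q) :
    ∃ T : Env k A →ₗ[k] Q, ∀ a b, T (ten k a b) = B a b :=
  ⟨(TensorProduct.lift (B.compl₂ (opLinearEquiv k).symm.toLinearMap) : A ⊗[k] Aᵐᵒᵖ →ₗ[k] Q),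
    fun _ _ ↦ rfl⟩

lemma mul_ten_one_injective [Module.Flat k A] {z : A} (hz : Function.Injective (z * ·)) :
    Function.Injective (· * ten k 1 z : Env k A → Env k A) := by
  let f : Aᵐᵒᵖ →ₗ[k] Aᵐᵒᵖ := LinearMap.mulRight k (op z)
  have hf : Function.Injective f := fun a b h ↦ unop_injective (hz (congrArg unop h))
  have key (y : Env k A) : y * ten k 1 z = f.lTensor A y := by
    induction y using ten_induction with
    | zero => rw [zero_mul]; exact (map_zero (f.lTensor A)).symm
    | ten a b => rw [ten_mul_ten, mul_one]; rfl
    | add x y hx hy => rw [add_mul, hx, hy]; exact (map_add (f.lTensor A) x y).symm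
  intro x y h
  exact Module.Flat.lTensor_preserves_injective_linearMap (M := A) f hf
    ((key x).symm.trans (h.trans (key y)))

/-- The diagonal bimodule structure. -/
instance diagonalModule : Module (Env k A) A :=
  (TensorProduct.Algebra.module : Module (A ⊗[k] Aᵐᵒᵖ) A)

lemma ten_smul (a b x : A) : ten k a b • x = a * x * b :=
  (TensorProduct.Algebra.smul_def a (op b) x).trans (mul_assoc a x b).symm

instance : IsScalarTower k (Env k A) A where
  smul_assoc c x a := by
    induction x using ten_induction with
    | zero => simp
    | ten x y => rw [← ten_smul_left, ten_smul, ten_smul]; simp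
    | add x y hx hy => rw [smul_add, add_smul, hx, hy, add_smul, smul_add]

section Module

variable {M : Type*} [AddCommGroup M] [Module (Env k A) M]

lemma ten_smul_ten_smul (a b c d : A) (m : M) :
    ten k a b • ten k c d • m = ten k (a * c) (d * b) • m := by
  rw [← mul_smul, ten_mul_ten]

end Module

section Derivation

variable {Q : Type*} [AddCommGroup Q] [Module (Env k A) Q] [Module k Q]

/-- A `k`-linear map from an algebra to a bimodule that satisfies the Leibniz rule
`D (a * b) = a * D b + D a * b`. -/
def IsBimoduleDerivation (D : A →ₗ[k] Q) : Prop :=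
  ∀ a b, D (a * b) = ten k a 1 • D b + ten k 1 b • D a

lemma IsBimoduleDerivation.exists_linearMap [IsScalarTower k (Env k A) Q] {D : A →ₗ[k] Q}
    (hD : IsBimoduleDerivation D) :
    ∃ T : Env k A →ₗ[k] Q, ∀ x a, T (x * (ten k a 1 - ten k 1 a)) = x • D a := by
  obtain ⟨T, hT⟩ := exists_env_lift (LinearMap.mk₂ k (fun a b ↦ ten k 1 b • D a)
    (fun a b c ↦ by rw [map_add, smul_add]) (fun r a b ↦ by rw [map_smul, smul_comm])
    (fun a b c ↦ by rw [ten_add_right, add_smul])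
    (fun r a b ↦ by rw [ten_smul_right, smul_assoc]))
  refine ⟨T, fun x a ↦ ?_⟩
  induction x using ten_induction with
  | zero => simp
  | add x y hx hy => rw [add_mul, map_add, hx, hy, add_smul]
  | ten b c =>
    rw [mul_sub, ten_mul_ten, ten_mul_ten, map_sub, hT, hT, mul_one, one_mul,
      LinearMap.mk₂_apply, LinearMap.mk₂_apply, hD, smul_add, ten_smul_ten_smul,
      ten_smul_ten_smul, one_mul, one_mul, mul_one, add_sub_cancel_right]

end Derivation

section SquareZeroExt

variable {Q : Type*} [AddCommGroup Q] [Module (Env k A) Q]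

/-- A bimodule as a left module. -/
abbrev leftModule (k A Q : Type*) [CommRing k] [Ring A] [Algebra k A] [AddCommGroup Q]
    [Module (Env k A) Q] : Module A Q :=
  Module.compHom Q (show A →+* Env k A from
    (Algebra.TensorProduct.includeLeft : A →ₐ[k] A ⊗[k] Aᵐᵒᵖ).toRingHom)

/-- A bimodule as a right module. -/
abbrev rightModule (k A Q : Type*) [CommRing k] [Ring A] [Algebra k A] [AddCommGroup Q]
    [Module (Env k A) Q] : Module Aᵐᵒᵖ Q :=
  Module.compHom Q (show Aᵐᵒᵖ →+* Env k A from
    (Algebra.TensorProduct.includeRight : Aᵐᵒᵖ →ₐ[k] A ⊗[k] Aᵐᵒᵖ).toRingHom)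

/-- The square zero extension `A ⊕ Q` of an algebra by a bimodule. An algebra homomorphism
`A → A ⊕ Q` that splits the projection to `A` is the same as a derivation from `A` to `Q`. -/
def SquareZeroExt (k A Q : Type*) [CommRing k] [Ring A] [Algebra k A] [AddCommGroup Q]
    [Module (Env k A) Q] : Type _ :=
  TrivSqZeroExt A Q

namespace SquareZeroExt

instance : Ring (SquareZeroExt k A Q) :=
  letI := leftModule k A Q
  letI := rightModule k A Q
  haveI : SMulCommClass A Aᵐᵒᵖ Q :=
    ⟨fun a b m ↦ show ten k a 1 • ten k 1 b.unop • m = ten k 1 b.unop • ten k a 1 • m by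
      simp only [ten_smul_ten_smul, mul_one, one_mul]⟩
  inferInstanceAs (Ring (TrivSqZeroExt A Q))

instance [Module k Q] : Module k (SquareZeroExt k A Q) :=
  inferInstanceAs (Module k (TrivSqZeroExt A Q))

instance [Module k Q] [IsScalarTower k (Env k A) Q] : Algebra k (SquareZeroExt k A Q) :=
  Algebra.ofModule
    (fun c x y ↦ Prod.ext (smul_mul_assoc c x.1 y.1) <|
      show ten k (c • x.1) 1 • y.2 + ten k 1 y.1 • c • x.2 =
          c • (ten k x.1 1 • y.2 + ten k 1 y.1 • x.2) by
        rw [ten_smul_left, smul_assoc, smul_add, smul_comm c (ten k 1 y.1)])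
    (fun c x y ↦ Prod.ext (mul_smul_comm c x.1 y.1) <|
      show ten k x.1 1 • c • y.2 + ten k 1 (c • y.1) • x.2 =
          c • (ten k x.1 1 • y.2 + ten k 1 y.1 • x.2) by
        rw [ten_smul_right, smul_assoc, smul_add, smul_comm c (ten k x.1 1)])

variable (k) in
/-- The pair `(a, m)` as an element of the square zero extension. -/
def mk (a : A) (m : Q) : SquareZeroExt k A Q := (a, m)

lemma mk_mul_mk (a b : A) (m n : Q) :
    mk k a m * mk k b n = mk k (a * b) (ten k a 1 • n + ten k 1 b • m) := rfl

lemma mk_zero_mul_mk (a b : A) (n : Q) : mk k a 0 * mk k b n = mk k (a * b) (ten k a 1 • n) := by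
  rw [mk_mul_mk, smul_zero, add_zero]

lemma mk_mul_mk_zero (a b : A) (m : Q) : mk k a m * mk k b 0 = mk k (a * b) (ten k 1 b • m) := by
  rw [mk_mul_mk, smul_zero, zero_add]

variable [Module k Q] [IsScalarTower k (Env k A) Q]

variable (k A Q) in
/-- The projection to `A`. -/
def fst : SquareZeroExt k A Q →ₐ[k] A :=
  AlgHom.ofLinearMap (LinearMap.fst k A Q) rfl fun _ _ ↦ rfl

variable (k A Q) in
/-- The projection to the ideal `Q`. -/
def snd : SquareZeroExt k A Q →ₗ[k] Q := LinearMap.snd k A Q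

lemma isBimoduleDerivation_snd_comp {φ : A →ₐ[k] SquareZeroExt k A Q}
    (hφ : (fst k A Q).comp φ = AlgHom.id k A) :
    IsBimoduleDerivation (snd k A Q ∘ₗ φ.toLinearMap) := fun a b ↦ by
  have h (a : A) : φ a = mk k a (snd k A Q (φ a)) := Prod.ext (AlgHom.congr_fun hφ a) rfl
  change snd k A Q (φ (a * b)) = ten k a 1 • snd k A Q (φ b) + ten k 1 b • snd k A Q (φ a)
  rw [map_mul, h a, h b, mk_mul_mk]
  rfl

end SquareZeroExt

end SquareZeroExt

end Bimodule

section ArrowSystem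

/-- A complete system of orthogonal idempotents in an algebra, thought of as the vertices of a
quiver, together with a family of elements that run between them, thought of as its arrows. Paths
are composed from right to left. -/
structure ArrowSystem (A V ι : Type*) [Ring A] [Fintype V] where
  idem : V → A
  src : ι → V
  tgt : ι → V
  arrow : ι → A
  complete : CompleteOrthogonalIdempotents idem
  idem_mul_arrow (α : ι) : idem (tgt α) * arrow α = arrow α
  arrow_mul_idem (α : ι) : arrow α * idem (src α) = arrow α

namespace ArrowSystem

variable {k A V ι : Type*} [CommRing k] [Ring A] [Algebra k A] [Fintype V]
  (S : ArrowSystem A V ι)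

variable (k) in
/-- The idempotent of a pair of vertices. It projects a bimodule to its paths from `j` to `i`. -/
def pairIdem (i j : V) : Env k A := ten k (S.idem i) (S.idem j)

lemma isIdempotentElem_pairIdem (i j : V) : IsIdempotentElem (S.pairIdem k i j) := by
  rw [IsIdempotentElem, pairIdem, ten_mul_ten, S.complete.idem, S.complete.idem]

section Module

variable {M : Type*} [AddCommGroup M] [Module (Env k A) M] {i j : V} {m : M}

variable {S}

lemma idem_left_smul (h : S.pairIdem k i j • m = m) : ten k (S.idem i) 1 • m = m := by
  rw [← h, pairIdem, ten_smul_ten_smul, S.complete.idem, mul_one]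

lemma idem_right_smul (h : S.pairIdem k i j • m = m) : ten k 1 (S.idem j) • m = m := by
  rw [← h, pairIdem, ten_smul_ten_smul, S.complete.idem, one_mul]

lemma pairIdem_smul_left {l : V} {a : A} (h : S.pairIdem k i j • m = m)
    (ha : S.idem l * a = a) : S.pairIdem k l j • ten k a 1 • m = ten k a 1 • m := by
  nth_rw 2 [← idem_right_smul h]
  rw [pairIdem, ten_smul_ten_smul, ten_smul_ten_smul, ha, one_mul, mul_one, mul_one]

lemma pairIdem_smul_right {l : V} {b : A} (h : S.pairIdem k i j • m = m)
    (hb : b * S.idem l = b) : S.pairIdem k i l • ten k 1 b • m = ten k 1 b • m := by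
  nth_rw 2 [← idem_left_smul h]
  rw [pairIdem, ten_smul_ten_smul, ten_smul_ten_smul, hb, one_mul, one_mul, mul_one]

end Module

variable (k)

/-- The free bimodule on the vertices. -/
abbrev P₀ : Type _ := IdemModule fun i : V ↦ S.pairIdem k i i

/-- The free bimodule on the arrows. -/
abbrev P₁ : Type _ := IdemModule fun α : ι ↦ S.pairIdem k (S.tgt α) (S.src α)

/-- The generator of the arrow bimodule at `α`. -/
def gen₁ (α : ι) : S.P₁ k :=
  IdemModule.gen (fun _ ↦ S.isIdempotentElem_pairIdem _ _) α

lemma pairIdem_smul_gen₁ (α : ι) :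
    S.pairIdem k (S.tgt α) (S.src α) • S.gen₁ k α = S.gen₁ k α :=
  IdemModule.smul_gen _ α

/-- The generator of the vertex bimodule at `i`. -/
def gen₀ (i : V) : S.P₀ k := IdemModule.gen (fun _ ↦ S.isIdempotentElem_pairIdem _ _) i

lemma pairIdem_smul_gen₀ (i : V) : S.pairIdem k i i • S.gen₀ k i = S.gen₀ k i :=
  IdemModule.smul_gen _ i

lemma induction₀ {p : S.P₀ k → Prop} (u : S.P₀ k) (zero : p 0)
    (smul_gen : ∀ (x : Env k A) i, p (x • S.gen₀ k i)) (add : ∀ u v, p u → p v → p (u + v)) : p u :=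
  IdemModule.induction (fun _ ↦ S.isIdempotentElem_pairIdem _ _) u zero smul_gen add

lemma induction₁ [Finite ι] {p : S.P₁ k → Prop} (u : S.P₁ k) (zero : p 0)
    (smul_gen : ∀ (x : Env k A) α, p (x • S.gen₁ k α)) (add : ∀ u v, p u → p v → p (u + v)) : p u :=
  IdemModule.induction (fun _ ↦ S.isIdempotentElem_pairIdem _ _) u zero smul_gen add

lemma hom_ext₁ [Finite ι] {M : Type*} [AddCommGroup M] [Module (Env k A) M]
    {f g : S.P₁ k →ₗ[Env k A] M} (h : ∀ α, f (S.gen₁ k α) = g (S.gen₁ k α)) : f = g :=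
  IdemModule.hom_ext (fun _ ↦ S.isIdempotentElem_pairIdem _ _) h

/-- The multiplication map from the vertex bimodule to the algebra. -/
def augmentation : S.P₀ k →ₗ[Env k A] A := IdemModule.lift _ S.idem

lemma augmentation_gen₀ (i : V) : S.augmentation k (S.gen₀ k i) = S.idem i := by
  rw [augmentation, gen₀, IdemModule.lift_gen, pairIdem, ten_smul, S.complete.idem,
    S.complete.idem]

lemma augmentation_surjective : Function.Surjective (S.augmentation k) := fun a ↦
  ⟨∑ i, ten k a 1 • S.gen₀ k i, by
    simp only [map_sum, map_smul, augmentation_gen₀, ten_smul, mul_one]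
    rw [← Finset.mul_sum, S.complete.complete, mul_one]⟩

lemma idem_left_smul_sum_gen₀ (i : V) :
    ten k (S.idem i) 1 • ∑ j, S.gen₀ k j = S.gen₀ k i := by
  rw [Finset.smul_sum, Fintype.sum_eq_single i fun j h ↦ ?_,
    idem_left_smul (S.pairIdem_smul_gen₀ k i)]
  rw [← idem_left_smul (S.pairIdem_smul_gen₀ k j), ten_smul_ten_smul, S.complete.ortho h.symm,
    ten_zero_left, zero_smul]

lemma idem_right_smul_sum_gen₀ (i : V) :
    ten k 1 (S.idem i) • ∑ j, S.gen₀ k j = S.gen₀ k i := by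
  rw [Finset.smul_sum, Fintype.sum_eq_single i fun j h ↦ ?_,
    idem_right_smul (S.pairIdem_smul_gen₀ k i)]
  rw [← idem_right_smul (S.pairIdem_smul_gen₀ k j), ten_smul_ten_smul, S.complete.ortho h,
    ten_zero_right, zero_smul]

variable [Fintype ι]

/-- The differential that sends the generator of an arrow `x` to its commutator `x * g - g * x`
with the generators `g` of its ends. -/
def diff₁ : S.P₁ k →ₗ[Env k A] S.P₀ k := IdemModule.lift _ fun α ↦
  ten k (S.arrow α) 1 • S.gen₀ k (S.src α) - ten k 1 (S.arrow α) • S.gen₀ k (S.tgt α)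

lemma diff₁_gen₁ (α : ι) : S.diff₁ k (S.gen₁ k α) =
    ten k (S.arrow α) 1 • S.gen₀ k (S.src α) - ten k 1 (S.arrow α) • S.gen₀ k (S.tgt α) := by
  rw [diff₁, gen₁, IdemModule.lift_gen, smul_sub,
    pairIdem_smul_left (S.pairIdem_smul_gen₀ k _) (S.idem_mul_arrow α),
    pairIdem_smul_right (S.pairIdem_smul_gen₀ k _) (S.arrow_mul_idem α)]

lemma augmentation_comp_diff₁ : S.augmentation k ∘ₗ S.diff₁ k = 0 := by
  refine S.hom_ext₁ k fun α ↦ ?_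
  rw [LinearMap.comp_apply, LinearMap.zero_apply, diff₁_gen₁, map_sub, map_smul, map_smul,
    augmentation_gen₀, augmentation_gen₀, ten_smul, ten_smul, mul_one, one_mul, S.arrow_mul_idem,
    S.idem_mul_arrow, sub_self]

/-- The idempotents and the arrows generate the algebra. -/
def Generates : Prop := Algebra.adjoin k (Set.range S.idem ∪ Set.range S.arrow) = ⊤

variable {k}

lemma commutator_sum_gen₀_mem_range (hS : S.Generates k) (a : A) :
    ten k a 1 • ∑ j, S.gen₀ k j - ten k 1 a • ∑ j, S.gen₀ k j ∈ LinearMap.range (S.diff₁ k) := by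
  have ha : a ∈ Algebra.adjoin k (Set.range S.idem ∪ Set.range S.arrow) := hS ▸ Algebra.mem_top
  induction ha using Algebra.adjoin_induction with
  | mem a ha =>
    rcases ha with ⟨i, rfl⟩ | ⟨α, rfl⟩
    · rw [idem_left_smul_sum_gen₀, idem_right_smul_sum_gen₀, sub_self]
      exact zero_mem _
    · refine ⟨S.gen₁ k α, ?_⟩
      rw [diff₁_gen₁, ← idem_left_smul_sum_gen₀, ← idem_right_smul_sum_gen₀ k S (S.tgt α),
        ten_smul_ten_smul, ten_smul_ten_smul, S.arrow_mul_idem, S.idem_mul_arrow, one_mul]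
  | algebraMap r =>
    rw [Algebra.algebraMap_eq_smul_one, ten_smul_left, ten_smul_right, sub_self]
    exact zero_mem _
  | add a b _ _ ha hb =>
    rw [ten_add_left, ten_add_right, add_smul, add_smul, add_sub_add_comm]
    exact add_mem ha hb
  | mul a b _ _ ha hb =>
    have := add_mem (Submodule.smul_mem _ (ten k a 1) hb) (Submodule.smul_mem _ (ten k 1 b) ha)
    simpa only [smul_sub, ten_smul_ten_smul, mul_one, one_mul, sub_add_sub_cancel] using this

lemma sub_smul_sum_gen₀_mem_range (hS : S.Generates k) (u : S.P₀ k) :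
    u - ten k 1 (S.augmentation k u) • ∑ j, S.gen₀ k j ∈ LinearMap.range (S.diff₁ k) := by
  induction u using S.induction₀ k with
  | zero => simp
  | add u v hu hv =>
    rw [map_add, ten_add_right, add_smul, add_sub_add_comm]
    exact add_mem hu hv
  | smul_gen x i =>
    rw [map_smul, augmentation_gen₀]
    induction x using ten_induction with
    | zero => simp
    | add x y hx hy =>
      rw [add_smul, add_smul, ten_add_right, add_smul, add_sub_add_comm]
      exact add_mem hx hy
    | ten a b =>
      have := Submodule.smul_mem _ (ten k 1 b)
        (S.commutator_sum_gen₀_mem_range hS (a * S.idem i))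
      rw [ten_smul, ← S.idem_left_smul_sum_gen₀ k, ten_smul_ten_smul]
      simpa only [smul_sub, ten_smul_ten_smul, mul_one, one_mul] using this

lemma exact_diff₁_augmentation (hS : S.Generates k) :
    Function.Exact (S.diff₁ k) (S.augmentation k) := fun u ↦ by
  refine ⟨fun hu ↦ ?_, ?_⟩
  · simpa [hu] using S.sub_smul_sum_gen₀_mem_range hS u
  · rintro ⟨v, rfl⟩
    exact LinearMap.congr_fun (S.augmentation_comp_diff₁ k) v

lemma map_eq_zero_of_diff₁_eq_zero {Q : Type*} [AddCommGroup Q] [Module (Env k A) Q] [Module k Q]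
    [IsScalarTower k (Env k A) Q] {D : A →ₗ[k] Q} (hD : IsBimoduleDerivation D)
    {f : S.P₁ k →ₗ[Env k A] Q} (hf : ∀ α, D (S.arrow α) = f (S.gen₁ k α)) {u : S.P₁ k}
    (hu : S.diff₁ k u = 0) : f u = 0 := by
  obtain ⟨T, hT⟩ := hD.exists_linearMap
  let σ : S.P₀ k →ₗ[Env k A] Env k A := IdemModule.lift _ fun _ ↦ 1
  have hσ₀ (i : V) : σ (S.gen₀ k i) = S.pairIdem k i i := by
    rw [gen₀, IdemModule.lift_gen, smul_eq_mul, mul_one]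
  have hσ (α : ι) : σ (S.diff₁ k (S.gen₁ k α)) =
      S.pairIdem k (S.tgt α) (S.src α) * (ten k (S.arrow α) 1 - ten k 1 (S.arrow α)) := by
    simp only [diff₁_gen₁, map_sub, map_smul, hσ₀, smul_eq_mul, pairIdem, mul_sub, ten_mul_ten,
      S.idem_mul_arrow, S.arrow_mul_idem, one_mul, mul_one]
  suffices h : f u = T (σ (S.diff₁ k u)) by rw [h, hu, map_zero, map_zero]
  clear hu
  induction u using S.induction₁ k with
  | zero => simp only [map_zero]
  | add u v hu hv => simp only [map_add, hu, hv]
  | smul_gen x α =>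
    rw [map_smul, map_smul, map_smul, hσ, smul_eq_mul, ← mul_assoc, hT, mul_smul, hf,
      ← map_smul f (S.pairIdem k _ _), pairIdem_smul_gen₁]

end ArrowSystem

end ArrowSystem

namespace KLRW

open Polynomial

variable (k : Type u) [Field k] {N : ℕ}

variable (N) in
/-- The algebra `Alg k N`, with `Ring` as the only source of its algebraic structure: the instances
of `RingQuot` would give competing ways to derive it. -/
def PathAlg : Type u := Alg k N

instance : Ring (PathAlg k N) := inferInstanceAs (Ring (Alg k N))

instance : Algebra k (PathAlg k N) := inferInstanceAs (Algebra k (Alg k N))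

variable (N) in
/-- The projection from the free algebra. -/
def quotMap : FreeAlgebra k (Gen N) →ₐ[k] PathAlg k N := RingQuot.mkAlgHom k (Rel k N)

/-- The trivial path at the vertex `i`. -/
def idem (i : Fin (N + 1)) : PathAlg k N := quotMap k N (gen k (.e i))

/-- The loop at the vertex `i`. -/
def loop (i : Fin (N + 1)) : PathAlg k N := quotMap k N (gen k (.s i))

/-- The arrow that crosses the `i`-th red strand from left to right. -/
def up (i : Fin N) : PathAlg k N := quotMap k N (gen k (.p i))

/-- The arrow that crosses the `i`-th red strand from right to left. -/
def down (i : Fin N) : PathAlg k N := quotMap k N (gen k (.q i))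

lemma quotMap_eq {x y : FreeAlgebra k (Gen N)} (h : Rel k N x y) :
    quotMap k N x = quotMap k N y :=
  RingQuot.mkAlgHom_rel k h

lemma quotMap_surjective : Function.Surjective (quotMap k N) :=
  RingQuot.mkAlgHom_surjective k (Rel k N)

@[simp] lemma idem_mul_self (i : Fin (N + 1)) : idem k i * idem k i = idem k i := by
  simpa [idem] using quotMap_eq k (.e_mul_self i)

lemma idem_mul_ne {i j : Fin (N + 1)} (h : i ≠ j) : idem k i * idem k j = 0 := by
  simpa [idem] using quotMap_eq k (.e_mul_ne i j h)

lemma sum_idem : ∑ i : Fin (N + 1), idem k i = 1 := by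
  simpa [idem] using quotMap_eq k (.sum_e (N := N))

@[simp] lemma idem_mul_loop (i : Fin (N + 1)) : idem k i * loop k i = loop k i := by
  simpa [idem, loop] using quotMap_eq k (.s_target i)

@[simp] lemma loop_mul_idem (i : Fin (N + 1)) : loop k i * idem k i = loop k i := by
  simpa [idem, loop] using quotMap_eq k (.s_source i)

@[simp] lemma idem_mul_up (i : Fin N) : idem k i.succ * up k i = up k i := by
  simpa [idem, up] using quotMap_eq k (.p_target i)

@[simp] lemma up_mul_idem (i : Fin N) : up k i * idem k i.castSucc = up k i := by
  simpa [idem, up] using quotMap_eq k (.p_source i)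

@[simp] lemma idem_mul_down (i : Fin N) : idem k i.castSucc * down k i = down k i := by
  simpa [idem, down] using quotMap_eq k (.q_target i)

@[simp] lemma down_mul_idem (i : Fin N) : down k i * idem k i.succ = down k i := by
  simpa [idem, down] using quotMap_eq k (.q_source i)

@[simp] lemma down_mul_up (i : Fin N) : down k i * up k i = loop k i.castSucc := by
  simpa [loop, up, down] using quotMap_eq k (.q_mul_p i)

@[simp] lemma up_mul_down (i : Fin N) : up k i * down k i = loop k i.succ := by
  simpa [loop, up, down] using quotMap_eq k (.p_mul_q i)

lemma loop_mul_up (i : Fin N) : loop k i.succ * up k i = up k i * loop k i.castSucc := by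
  simpa [loop, up, down] using quotMap_eq k (.s_mul_p i)

lemma loop_mul_down (i : Fin N) : loop k i.castSucc * down k i = down k i * loop k i.succ := by
  simpa [loop, up, down] using quotMap_eq k (.s_mul_q i)

variable {k} in
lemma mem_of_generators_mem (S : Subalgebra k (PathAlg k N)) (he : ∀ i, idem k i ∈ S)
    (hs : ∀ i, loop k i ∈ S) (hp : ∀ i, up k i ∈ S) (hq : ∀ i, down k i ∈ S) (a : PathAlg k N) :
    a ∈ S := by
  obtain ⟨x, rfl⟩ := quotMap_surjective k a
  induction x using FreeAlgebra.induction with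
  | grade0 r => simp
  | grade1 g =>
    cases g with
    | e i => exact he i
    | s i => exact hs i
    | p i => exact hp i
    | q i => exact hq i
  | mul x y hx hy => simpa using S.mul_mem hx hy
  | add x y hx hy => simpa using S.add_mem hx hy

section lift

variable {k} {B : Type*} [Ring B] [Algebra k B]

/-- The homomorphism given by values of the generators that satisfy the relations. -/
def lift (x : Gen N → B) (h : ∀ ⦃a b : FreeAlgebra k (Gen N)⦄, Rel k N a b →
    FreeAlgebra.lift k x a = FreeAlgebra.lift k x b) : PathAlg k N →ₐ[k] B :=
  RingQuot.liftAlgHom k ⟨FreeAlgebra.lift k x, h⟩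

lemma lift_quotMap_gen (x : Gen N → B) (h : ∀ ⦃a b : FreeAlgebra k (Gen N)⦄, Rel k N a b →
    FreeAlgebra.lift k x a = FreeAlgebra.lift k x b) (g : Gen N) :
    lift x h (quotMap k N (gen k g)) = x g :=
  (RingQuot.liftAlgHom_mkAlgHom_apply k _ h _).trans (FreeAlgebra.lift_ι_apply x g)

lemma algHom_ext {φ ψ : PathAlg k N →ₐ[k] B}
    (h : ∀ g, φ (quotMap k N (gen k g)) = ψ (quotMap k N (gen k g))) : φ = ψ :=
  RingQuot.ringQuot_ext' k φ ψ (FreeAlgebra.hom_ext (funext h))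

end lift

section rep

/-- The values on the generators of the matrix representation over `k[X]`. -/
def repGen (N : ℕ) : Gen N → Matrix (Fin (N + 1)) (Fin (N + 1)) k[X]
  | .e i => Matrix.single i i 1
  | .s i => Matrix.single i i X
  | .p i => Matrix.single i.succ i.castSucc 1
  | .q i => Matrix.single i.castSucc i.succ X

/-- The representation by matrices over `k[X]` where the loops act as multiplication by `X`, the
arrows to the right as identities, and the arrows to the left as multiplication by `X`. -/
def rep (N : ℕ) : PathAlg k N →ₐ[k] Matrix (Fin (N + 1)) (Fin (N + 1)) k[X] :=
  lift (repGen k N) fun a b h ↦ by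
    cases h with
    | sum_e => simpa [repGen] using Matrix.sum_single_one
    | e_mul_ne i j h => simp [repGen, h]
    | _ => simp [repGen]

lemma rep_idem (i : Fin (N + 1)) : rep k N (idem k i) = Matrix.single i i 1 :=
  lift_quotMap_gen ..

lemma rep_loop (i : Fin (N + 1)) : rep k N (loop k i) = Matrix.single i i X :=
  lift_quotMap_gen ..

lemma rep_up (i : Fin N) : rep k N (up k i) = Matrix.single i.succ i.castSucc 1 :=
  lift_quotMap_gen ..

lemma rep_down (i : Fin N) : rep k N (down k i) = Matrix.single i.castSucc i.succ X :=
  lift_quotMap_gen ..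

end rep

/-- The central element `z`, the sum of all loops. -/
def ctr (N : ℕ) : PathAlg k N := ∑ i, loop k i

lemma idem_mul_loop_ne {i j : Fin (N + 1)} (h : i ≠ j) : idem k i * loop k j = 0 := by
  rw [← idem_mul_loop, ← mul_assoc, idem_mul_ne k h, zero_mul]

lemma loop_mul_idem_ne {i j : Fin (N + 1)} (h : i ≠ j) : loop k i * idem k j = 0 := by
  rw [← loop_mul_idem, mul_assoc, idem_mul_ne k h, mul_zero]

lemma ctr_mul_idem (i : Fin (N + 1)) : ctr k N * idem k i = loop k i := by
  rw [ctr, Finset.sum_mul, Finset.sum_eq_single i (fun j _ h ↦ loop_mul_idem_ne k h) (by simp),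
    loop_mul_idem]

lemma idem_mul_ctr (i : Fin (N + 1)) : idem k i * ctr k N = loop k i := by
  rw [ctr, Finset.mul_sum, Finset.sum_eq_single i (fun j _ h ↦ idem_mul_loop_ne k h.symm) (by simp),
    idem_mul_loop]

lemma ctr_commute (a : PathAlg k N) : Commute (ctr k N) a := by
  have key := mem_of_generators_mem (Subalgebra.centralizer k {ctr k N}) ?_ ?_ ?_ ?_ a
  · exact (Subalgebra.mem_centralizer_iff k).1 key _ rfl
  all_goals
    intro i
    rw [Subalgebra.mem_centralizer_iff]
    rintro _ rfl
  · rw [ctr_mul_idem, idem_mul_ctr]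
  · rw [← ctr_mul_idem, mul_assoc, ctr_mul_idem, ← idem_mul_ctr]
  · rw [← idem_mul_up, ← mul_assoc, ctr_mul_idem, loop_mul_up, idem_mul_up, ← idem_mul_ctr,
      ← mul_assoc, up_mul_idem]
  · rw [← idem_mul_down, ← mul_assoc, ctr_mul_idem, loop_mul_down, idem_mul_down, ← idem_mul_ctr,
      ← mul_assoc, down_mul_idem]

/-- The polynomial `f` evaluated at the central element. -/
abbrev ev (N : ℕ) (f : k[X]) : PathAlg k N := aeval (ctr k N) f

variable {k} in
lemma ev_commute (f : k[X]) (a : PathAlg k N) : Commute (ev k N f) a :=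
  Algebra.commute_of_mem_adjoin_singleton_of_commute (aeval_mem_adjoin_singleton k _)
    (ctr_commute k a).symm |>.symm

lemma rep_ctr : rep k N (ctr k N) = algebraMap k[X] _ X := by
  rw [ctr, map_sum, Algebra.algebraMap_eq_smul_one, ← Matrix.sum_single_one, Finset.smul_sum]
  simp [rep_loop, Matrix.smul_single]

lemma rep_ev (f : k[X]) : rep k N (ev k N f) = algebraMap k[X] _ f := by
  rw [ev, ← aeval_algHom_apply, rep_ctr, aeval_algebraMap_apply, aeval_X_left_apply]

/-- The sum of all arrows `i ⟶ i + 1`. -/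
def ups (N : ℕ) : PathAlg k N := ∑ i, up k i

/-- The sum of all arrows `i + 1 ⟶ i`. -/
def downs (N : ℕ) : PathAlg k N := ∑ i, down k i

lemma ups_mul_idem (i : Fin N) : ups k N * idem k i.castSucc = up k i := by
  rw [ups, Finset.sum_mul, Finset.sum_eq_single i _ (by simp), up_mul_idem]
  intro j _ h
  rw [← up_mul_idem, mul_assoc, idem_mul_ne k (by simpa using h), mul_zero]

lemma downs_mul_idem (i : Fin N) : downs k N * idem k i.succ = down k i := by
  rw [downs, Finset.sum_mul, Finset.sum_eq_single i _ (by simp), down_mul_idem]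
  intro j _ h
  rw [← down_mul_idem, mul_assoc, idem_mul_ne k (by simpa using h), mul_zero]

lemma idem_mul_ups_pow (n : ℕ) (i j : Fin (N + 1)) (h : (i : ℕ) = j + n) :
    idem k i * (ups k N ^ n * idem k j) = ups k N ^ n * idem k j := by
  induction n generalizing i with
  | zero => obtain rfl : i = j := Fin.ext h; simp
  | succ n ih =>
    obtain ⟨i, rfl⟩ := Fin.exists_succ_eq.2 (show i ≠ 0 by rintro rfl; simp at h)
    have := ih i.castSucc (by rw [Fin.val_succ] at h; rw [Fin.val_castSucc]; omega)
    rw [pow_succ', mul_assoc, ← this, ← mul_assoc (ups k N), ups_mul_idem, ← mul_assoc, idem_mul_up]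

lemma idem_mul_downs_pow (n : ℕ) (i j : Fin (N + 1)) (h : (j : ℕ) = i + n) :
    idem k i * (downs k N ^ n * idem k j) = downs k N ^ n * idem k j := by
  induction n generalizing i with
  | zero => obtain rfl : i = j := Fin.ext h.symm; simp
  | succ n ih =>
    obtain ⟨i, rfl⟩ := Fin.exists_castSucc_eq.2 (show i ≠ Fin.last N by
      rintro rfl; have := j.2; rw [Fin.val_last] at h; omega)
    have := ih i.succ (by rw [Fin.val_castSucc] at h; rw [Fin.val_succ]; omega)
    rw [pow_succ', mul_assoc, ← this, ← mul_assoc (downs k N), downs_mul_idem, ← mul_assoc,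
      idem_mul_down]

/-- The shortest path from `j` to `i`. -/
def path (i j : Fin (N + 1)) : PathAlg k N :=
  if j ≤ i then ups k N ^ (i - j : ℕ) * idem k j else downs k N ^ (j - i : ℕ) * idem k j

@[simp] lemma path_self (i : Fin (N + 1)) : path k i i = idem k i := by simp [path]

@[simp] lemma path_succ_castSucc (i : Fin N) : path k i.succ i.castSucc = up k i := by
  rw [path, if_pos i.castSucc_lt_succ.le]
  simp [ups_mul_idem]

@[simp] lemma path_castSucc_succ (i : Fin N) : path k i.castSucc i.succ = down k i := by
  rw [path, if_neg i.castSucc_lt_succ.not_ge]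
  simp [downs_mul_idem]

@[simp] lemma idem_mul_path (i j : Fin (N + 1)) : idem k i * path k i j = path k i j := by
  rw [path]
  split_ifs with h
  · exact idem_mul_ups_pow k _ _ _ (by rw [Fin.le_def] at h; omega)
  · exact idem_mul_downs_pow k _ _ _ (by rw [Fin.le_def] at h; omega)

lemma path_succ_of_le {i : Fin N} {j : Fin (N + 1)} (h : j ≤ i.castSucc) :
    path k i.succ j = up k i * path k i.castSucc j := by
  rw [← ups_mul_idem, mul_assoc, idem_mul_path, path, path, if_pos h,
    if_pos (h.trans i.castSucc_lt_succ.le), ← mul_assoc, ← pow_succ']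
  congr 2
  rw [Fin.le_def, Fin.val_castSucc] at h
  rw [Fin.val_succ, Fin.val_castSucc]
  omega

lemma path_castSucc_of_le {i : Fin N} {j : Fin (N + 1)} (h : i.succ ≤ j) :
    path k i.castSucc j = down k i * path k i.succ j := by
  rcases h.eq_or_lt with rfl | h'
  · simp
  rw [← downs_mul_idem, mul_assoc, idem_mul_path, path, path, if_neg h'.not_ge,
    if_neg (i.castSucc_lt_succ.trans h').not_ge, ← mul_assoc, ← pow_succ']
  congr 2
  rw [Fin.lt_def, Fin.val_succ] at h'
  rw [Fin.val_succ, Fin.val_castSucc]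
  omega

lemma up_mul_path_of_le {i : Fin N} {j : Fin (N + 1)} (h : i.succ ≤ j) :
    up k i * path k i.castSucc j = ctr k N * path k i.succ j := by
  rw [path_castSucc_of_le k h, ← mul_assoc, up_mul_down, ← ctr_mul_idem, mul_assoc, idem_mul_path]

lemma down_mul_path_of_le {i : Fin N} {j : Fin (N + 1)} (h : j ≤ i.castSucc) :
    down k i * path k i.succ j = ctr k N * path k i.castSucc j := by
  rw [path_succ_of_le k h, ← mul_assoc, down_mul_up, ← ctr_mul_idem, mul_assoc, idem_mul_path]

lemma path_mul_idem (i j : Fin (N + 1)) : path k i j * idem k j = path k i j := by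
  rw [path]
  split_ifs <;> rw [mul_assoc, idem_mul_self]

lemma rep_path (i j : Fin (N + 1)) :
    rep k N (path k i j) = Matrix.single i j (X ^ (j - i : ℕ)) := by
  rcases le_total j i with h | h
  · induction i using Fin.induction with
    | zero =>
      obtain rfl : j = 0 := by simpa using h
      simp [rep_idem]
    | succ i ih =>
      rcases h.eq_or_lt with rfl | h'
      · simp [rep_idem]
      have h'' : j ≤ i.castSucc := Fin.le_castSucc_iff.2 h'
      rw [path_succ_of_le k h'', map_mul, ih h'', rep_up, Matrix.single_mul_single_same, one_mul,
        Nat.sub_eq_zero_of_le h, Nat.sub_eq_zero_of_le h'']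
  · induction i using Fin.reverseInduction with
    | last =>
      obtain rfl : j = Fin.last N := by simpa using h
      simp [rep_idem]
    | cast i ih =>
      rcases h.eq_or_lt with rfl | h'
      · simp [rep_idem]
      have h'' : i.succ ≤ j := Fin.castSucc_lt_iff_succ_le.1 h'
      have hsub : (j - i.castSucc : ℕ) = (j - i.succ : ℕ) + 1 := by
        rw [Fin.le_def, Fin.val_succ] at h''
        rw [Fin.val_succ, Fin.val_castSucc]
        omega
      rw [path_castSucc_of_le k h'', map_mul, ih h'', rep_down, Matrix.single_mul_single_same, hsub,
        pow_succ']

lemma rep_ev_mul_path (f : k[X]) (i j : Fin (N + 1)) :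
    rep k N (ev k N f * path k i j) = Matrix.single i j (f * X ^ (j - i : ℕ)) := by
  rw [map_mul, rep_ev, rep_path, ← Algebra.smul_def, Matrix.smul_single, smul_eq_mul]

variable {k} in
lemma eq_zero_of_rep_ev_mul_path_eq_zero {f : k[X]} {i j : Fin (N + 1)}
    (h : rep k N (ev k N f * path k i j) = 0) : f = 0 := by
  rw [rep_ev_mul_path] at h
  simpa [Matrix.single_apply_same] using congrFun₂ h i j

/-- The elements all of whose components are multiples of shortest paths. -/
def pathSpan (N : ℕ) : Submodule k (PathAlg k N) where
  carrier := {a | ∀ i j, ∃ f : k[X], idem k i * a * idem k j = ev k N f * path k i j}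
  zero_mem' i j := ⟨0, by simp⟩
  add_mem' := by
    intro a b ha hb i j
    obtain ⟨f, hf⟩ := ha i j
    obtain ⟨g, hg⟩ := hb i j
    exact ⟨f + g, by rw [mul_add, add_mul, hf, hg, ← add_mul, ← map_add]⟩
  smul_mem' := by
    intro c a ha i j
    obtain ⟨f, hf⟩ := ha i j
    exact ⟨c • f, by simp [hf]⟩

lemma mul_mem_pathSpan {i j : Fin (N + 1)} {x b : PathAlg k N} (hi : idem k i * x = x)
    (hj : x * idem k j = x) (h : ∀ l, ∃ n : ℕ, x * path k j l = ctr k N ^ n * path k i l)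
    (hb : b ∈ pathSpan k N) : x * b ∈ pathSpan k N := by
  intro i' l
  rcases eq_or_ne i' i with rfl | hne
  · obtain ⟨n, hn⟩ := h l
    obtain ⟨f, hf⟩ := hb j l
    refine ⟨f * X ^ n, ?_⟩
    calc idem k i' * (x * b) * idem k l
        = x * (idem k j * b * idem k l) := by
          rw [← mul_assoc, hi, ← mul_assoc, ← mul_assoc, hj]
      _ = ev k N f * (x * path k j l) := by
          rw [hf, ← mul_assoc, ← (ev_commute f x).eq, mul_assoc]
      _ = ev k N (f * X ^ n) * path k i' l := by
          rw [hn, ← mul_assoc, ev, ev, map_mul, map_pow, aeval_X]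
  · exact ⟨0, by rw [← hi, mul_assoc (idem k i), ← mul_assoc (idem k i') (idem k i),
      idem_mul_ne k hne, zero_mul, zero_mul, ev, map_zero, zero_mul]⟩

lemma mem_pathSpan (a : PathAlg k N) : a ∈ pathSpan k N := by
  let S : Subalgebra k (PathAlg k N) :=
    { carrier := {a | ∀ b ∈ pathSpan k N, a * b ∈ pathSpan k N}
      mul_mem' := fun {x y} hx hy b hb ↦ by rw [mul_assoc]; exact hx _ (hy _ hb)
      add_mem' := fun {x y} hx hy b hb ↦ by
        rw [add_mul]; exact (pathSpan k N).add_mem (hx _ hb) (hy _ hb)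
      algebraMap_mem' := fun r b hb ↦ by
        rw [← Algebra.smul_def]; exact (pathSpan k N).smul_mem r hb }
  have one_mem : (1 : PathAlg k N) ∈ pathSpan k N := by
    intro i j
    by_cases h : i = j
    · subst h
      exact ⟨1, by simp⟩
    · exact ⟨0, by simp [idem_mul_ne k h]⟩
  have h := mem_of_generators_mem S ?_ ?_ ?_ ?_ a 1 one_mem
  · simpa using h
  · intro i b hb
    exact mul_mem_pathSpan k (idem_mul_self k i) (idem_mul_self k i) (fun l ↦ ⟨0, by simp⟩) hb
  · intro i b hb
    exact mul_mem_pathSpan k (idem_mul_loop k i) (loop_mul_idem k i) (fun l ↦ ⟨1, by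
      rw [← ctr_mul_idem, mul_assoc, idem_mul_path, pow_one]⟩) hb
  · intro i b hb
    refine mul_mem_pathSpan k (idem_mul_up k i) (up_mul_idem k i) (fun l ↦ ?_) hb
    rcases le_or_gt l i.castSucc with h | h
    · exact ⟨0, by simp [path_succ_of_le k h]⟩
    · exact ⟨1, by rw [up_mul_path_of_le k (Fin.castSucc_lt_iff_succ_le.1 h), pow_one]⟩
  · intro i b hb
    refine mul_mem_pathSpan k (idem_mul_down k i) (down_mul_idem k i) (fun l ↦ ?_) hb
    rcases le_or_gt l i.castSucc with h | h
    · exact ⟨1, by rw [down_mul_path_of_le k h, pow_one]⟩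
    · exact ⟨0, by simp [path_castSucc_of_le k (Fin.castSucc_lt_iff_succ_le.1 h)]⟩

variable {k} in
lemma exists_component (a : PathAlg k N) (i j : Fin (N + 1)) :
    ∃ f : k[X], idem k i * a * idem k j = ev k N f * path k i j :=
  mem_pathSpan k a i j

variable {k} in
lemma eq_zero_of_components {a : PathAlg k N} (h : ∀ i j, idem k i * a * idem k j = 0) : a = 0 := by
  rw [← one_mul a, ← mul_one (1 * a), ← sum_idem, Finset.sum_mul, Finset.sum_mul_sum]
  exact Finset.sum_eq_zero fun i _ ↦ Finset.sum_eq_zero fun j _ ↦ h i j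

lemma rep_injective : Function.Injective (rep k N) := by
  refine (injective_iff_map_eq_zero _).2 fun a ha ↦ eq_zero_of_components fun i j ↦ ?_
  obtain ⟨f, hf⟩ := exists_component a i j
  have : rep k N (ev k N f * path k i j) = 0 := by
    rw [← hf, map_mul, map_mul, ha, mul_zero, zero_mul]
  rw [hf, eq_zero_of_rep_ev_mul_path_eq_zero this, ev, map_zero, zero_mul]

lemma ctr_mul_injective : Function.Injective (ctr k N * ·) := fun a b h ↦ by
  refine rep_injective k (smul_right_injective _ (X_ne_zero (R := k)) ?_)
  simpa [rep_ctr, ← Algebra.smul_def] using congrArg (rep k N) h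

end KLRW

namespace KLRW

variable (k : Type u) [Field k] {N : ℕ}

/-- The arrows that generate the algebra over the trivial paths. The loops at the vertices other
than `0` are composites of these arrows, so they are left out. -/
inductive Arrow (N : ℕ) : Type
  | loop₀ : Arrow N
  | up (i : Fin N) : Arrow N
  | down (i : Fin N) : Arrow N

instance : Fintype (Arrow N) :=
  .ofEquiv (Option (Fin N ⊕ Fin N))
    { toFun
        | none => .loop₀
        | some (.inl i) => .up i
        | some (.inr i) => .down i
      invFun
        | .loop₀ => none
        | .up i => some (.inl i)
        | .down i => some (.inr i)
      left_inv := by rintro (_ | _ | _) <;> rfl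
      right_inv := by rintro (_ | _ | _) <;> rfl }

variable (N) in
/-- The algebra with its trivial paths and its generating arrows. -/
def arrowSystem : ArrowSystem (PathAlg k N) (Fin (N + 1)) (Arrow N) where
  idem := idem k
  src
    | .loop₀ => 0
    | .up i => i.castSucc
    | .down i => i.succ
  tgt
    | .loop₀ => 0
    | .up i => i.succ
    | .down i => i.castSucc
  arrow
    | .loop₀ => loop k 0
    | .up i => up k i
    | .down i => down k i
  complete := ⟨⟨idem_mul_self k, fun _ _ h ↦ idem_mul_ne k h⟩, sum_idem k⟩
  idem_mul_arrow
    | .loop₀ => idem_mul_loop k 0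
    | .up i => idem_mul_up k i
    | .down i => idem_mul_down k i
  arrow_mul_idem
    | .loop₀ => loop_mul_idem k 0
    | .up i => up_mul_idem k i
    | .down i => down_mul_idem k i

lemma generates_arrowSystem : (arrowSystem k N).Generates k := by
  have hidem (i) : idem k i ∈ Algebra.adjoin k (Set.range (arrowSystem k N).idem ∪
      Set.range (arrowSystem k N).arrow) := Algebra.subset_adjoin (.inl ⟨i, rfl⟩)
  have harrow (α) : (arrowSystem k N).arrow α ∈ Algebra.adjoin k (Set.range (arrowSystem k N).idem ∪
      Set.range (arrowSystem k N).arrow) := Algebra.subset_adjoin (.inr ⟨α, rfl⟩)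
  refine Algebra.eq_top_iff.2 fun a ↦ mem_of_generators_mem _ hidem (fun i ↦ ?_)
    (fun i ↦ harrow (.up i)) (fun i ↦ harrow (.down i)) a
  cases i using Fin.cases with
  | zero => exact harrow .loop₀
  | succ i =>
    rw [← up_mul_down]
    exact mul_mem (harrow (.up i)) (harrow (.down i))

section Derivation

variable {M : Type*} [AddCommGroup M] [Module (Env k (PathAlg k N)) M] (d : Arrow N → M)

/-- The value at the loops of the derivation with values `d` at the arrows. -/
def loopValue : Fin (N + 1) → M :=
  Fin.cases (d .loop₀) fun j ↦ ten k (up k j) 1 • d (.down j) + ten k 1 (down k j) • d (.up j)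

/-- The value at the relation `q p = s` at the vertex `i` of the derivation with values `d` at the
arrows, computed by the Leibniz rule. -/
def relationValue (i : Fin N) : M :=
  ten k (down k i) 1 • d (.up i) + ten k 1 (up k i) • d (.down i) - loopValue k d i.castSucc

/-- The values on the generators of the homomorphism to the square zero extension that corresponds
to the derivation with values `d` at the arrows. -/
def derivationGen : Gen N → SquareZeroExt k (PathAlg k N) M
  | .e i => .mk k (idem k i) 0
  | .s i => .mk k (loop k i) (loopValue k d i)
  | .p i => .mk k (up k i) (d (.up i))
  | .q i => .mk k (down k i) (d (.down i))

variable {k d}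

section map

variable {M' : Type*} [AddCommGroup M'] [Module (Env k (PathAlg k N)) M']
  (f : M →ₗ[Env k (PathAlg k N)] M')

lemma map_loopValue (i : Fin (N + 1)) :
    f (loopValue k d i) = loopValue k (f ∘ d) i := by
  cases i using Fin.cases with
  | zero => rfl
  | succ j => simp only [loopValue, Fin.cases_succ, map_add, map_smul, Function.comp_apply]

lemma map_relationValue (i : Fin N) :
    f (relationValue k d i) = relationValue k (f ∘ d) i := by
  simp only [relationValue, map_sub, map_add, map_smul, map_loopValue, Function.comp_apply]

end map

variable (hd : ∀ α, (arrowSystem k N).pairIdem k ((arrowSystem k N).tgt α)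
  ((arrowSystem k N).src α) • d α = d α)

include hd

lemma pairIdem_smul_loopValue (i : Fin (N + 1)) :
    (arrowSystem k N).pairIdem k i i • loopValue k d i = loopValue k d i := by
  cases i using Fin.cases with
  | zero => exact hd .loop₀
  | succ j =>
    rw [loopValue, Fin.cases_succ, smul_add]
    exact congrArg₂ (· + ·) (ArrowSystem.pairIdem_smul_left (hd (.down j)) (idem_mul_up k j))
      (ArrowSystem.pairIdem_smul_right (hd (.up j)) (down_mul_idem k j))

lemma pairIdem_smul_relationValue (i : Fin N) :
    (arrowSystem k N).pairIdem k i.castSucc i.castSucc • relationValue k d i =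
      relationValue k d i := by
  rw [relationValue, smul_sub, smul_add, pairIdem_smul_loopValue hd]
  exact congrArg (· - loopValue k d i.castSucc) <| congrArg₂ (· + ·)
    (ArrowSystem.pairIdem_smul_left (hd (.up i)) (idem_mul_down k i))
    (ArrowSystem.pairIdem_smul_right (hd (.down i)) (up_mul_idem k i))

variable [Module k M] [IsScalarTower k (Env k (PathAlg k N)) M]

lemma lift_derivationGen_eq (hr : ∀ i, relationValue k d i = 0) ⦃a b : FreeAlgebra k (Gen N)⦄
    (h : Rel k N a b) :
    FreeAlgebra.lift k (derivationGen k d) a = FreeAlgebra.lift k (derivationGen k d) b := by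
  have hqp (i : Fin N) : derivationGen k d (.q i) * derivationGen k d (.p i) =
      derivationGen k d (.s i.castSucc) :=
    Prod.ext (down_mul_up k i) (sub_eq_zero.1 (hr i))
  have hpq (i : Fin N) : derivationGen k d (.p i) * derivationGen k d (.q i) =
      derivationGen k d (.s i.succ) :=
    Prod.ext (up_mul_down k i) rfl
  have htgt (α) : ten k (idem k ((arrowSystem k N).tgt α)) 1 • d α = d α :=
    ArrowSystem.idem_left_smul (hd α)
  have hsrc (α) : ten k 1 (idem k ((arrowSystem k N).src α)) • d α = d α :=
    ArrowSystem.idem_right_smul (hd α)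
  have hloop (i) := pairIdem_smul_loopValue hd i
  have hmk {a b : PathAlg k N} {m n : M} (h : a = b) (h' : m = n) :
      SquareZeroExt.mk k a m = .mk k b n := congrArg₂ _ h h'
  cases h with simp only [gen, map_mul, map_sum, map_one, map_zero, FreeAlgebra.lift_ι_apply,
    derivationGen, SquareZeroExt.mk_zero_mul_mk, SquareZeroExt.mk_mul_mk_zero]
  | sum_e =>
    exact (map_sum (AddMonoidHom.inl (PathAlg k N) M) (idem k) Finset.univ).symm.trans
      (congrArg (·, (0 : M)) (sum_idem k))
  | e_mul_self i => exact hmk (idem_mul_self k i) (smul_zero _)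
  | e_mul_ne i j h => exact hmk (idem_mul_ne k h) (smul_zero _)
  | s_target i => exact hmk (idem_mul_loop k i) (ArrowSystem.idem_left_smul (hloop i))
  | s_source i => exact hmk (loop_mul_idem k i) (ArrowSystem.idem_right_smul (hloop i))
  | p_target i => exact hmk (idem_mul_up k i) (htgt (.up i))
  | p_source i => exact hmk (up_mul_idem k i) (hsrc (.up i))
  | q_target i => exact hmk (idem_mul_down k i) (htgt (.down i))
  | q_source i => exact hmk (down_mul_idem k i) (hsrc (.down i))
  | q_mul_p i => exact hqp i
  | p_mul_q i => exact hpq i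
  | s_mul_p i =>
    exact (congrArg (· * derivationGen k d (.p i)) (hpq i)).symm.trans
      ((mul_assoc ..).trans (congrArg (derivationGen k d (.p i) * ·) (hqp i)))
  | s_mul_q i =>
    exact (congrArg (· * derivationGen k d (.q i)) (hqp i)).symm.trans
      ((mul_assoc ..).trans (congrArg (derivationGen k d (.q i) * ·) (hpq i)))

lemma exists_derivation (hr : ∀ i, relationValue k d i = 0) :
    ∃ D : PathAlg k N →ₗ[k] M, IsBimoduleDerivation D ∧
      ∀ α, D ((arrowSystem k N).arrow α) = d α := by
  let φ := lift (derivationGen k d) (lift_derivationGen_eq hd hr)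
  have hφ (g) : φ (quotMap k N (gen k g)) = derivationGen k d g := lift_quotMap_gen ..
  have hfst : (SquareZeroExt.fst k (PathAlg k N) M).comp φ = AlgHom.id k _ :=
    algHom_ext fun g ↦ by
      rw [AlgHom.comp_apply, hφ]
      cases g <;> rfl
  refine ⟨_, SquareZeroExt.isBimoduleDerivation_snd_comp hfst, fun α ↦ ?_⟩
  cases α with
  | loop₀ => exact congrArg Prod.snd (hφ (.s 0))
  | up i => exact congrArg Prod.snd (hφ (.p i))
  | down i => exact congrArg Prod.snd (hφ (.q i))

end Derivation

section Resolution

variable (N) in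
/-- The free bimodule on the relations `q p = s`, each of which has both ends at the source of the
arrow `p`. -/
abbrev P₂ : Type _ :=
  IdemModule fun i : Fin N ↦ (arrowSystem k N).pairIdem k i.castSucc i.castSucc

/-- The generator of the bimodule of relations at `i`. -/
def gen₂ (i : Fin N) : P₂ k N :=
  IdemModule.gen (fun _ ↦ (arrowSystem k N).isIdempotentElem_pairIdem _ _) i

variable (N) in
/-- The differential that sends a relation to its universal derivation. -/
def diff₂ : P₂ k N →ₗ[Env k (PathAlg k N)] (arrowSystem k N).P₁ k :=
  IdemModule.lift _ (relationValue k ((arrowSystem k N).gen₁ k))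

lemma diff₂_gen₂ (i : Fin N) :
    diff₂ k N (gen₂ k i) = relationValue k ((arrowSystem k N).gen₁ k) i := by
  rw [diff₂, gen₂, IdemModule.lift_gen,
    pairIdem_smul_relationValue ((arrowSystem k N).pairIdem_smul_gen₁ k)]

lemma diff₁_gen₁_up (i : Fin N) :
    (arrowSystem k N).diff₁ k ((arrowSystem k N).gen₁ k (.up i)) =
      ten k (up k i) 1 • (arrowSystem k N).gen₀ k i.castSucc -
        ten k 1 (up k i) • (arrowSystem k N).gen₀ k i.succ :=
  (arrowSystem k N).diff₁_gen₁ k (.up i)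

lemma diff₁_gen₁_down (i : Fin N) :
    (arrowSystem k N).diff₁ k ((arrowSystem k N).gen₁ k (.down i)) =
      ten k (down k i) 1 • (arrowSystem k N).gen₀ k i.succ -
        ten k 1 (down k i) • (arrowSystem k N).gen₀ k i.castSucc :=
  (arrowSystem k N).diff₁_gen₁ k (.down i)

lemma loopValue_diff₁ (i : Fin (N + 1)) :
    loopValue k ((arrowSystem k N).diff₁ k ∘ (arrowSystem k N).gen₁ k) i =
      ten k (loop k i) 1 • (arrowSystem k N).gen₀ k i -
        ten k 1 (loop k i) • (arrowSystem k N).gen₀ k i := by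
  cases i using Fin.cases with
  | zero => exact (arrowSystem k N).diff₁_gen₁ k .loop₀
  | succ j =>
    simp only [loopValue, Fin.cases_succ, Function.comp_apply, diff₁_gen₁_up, diff₁_gen₁_down,
      smul_sub, ten_smul_ten_smul, mul_one, one_mul, up_mul_down]
    abel

lemma diff₁_comp_diff₂ : (arrowSystem k N).diff₁ k ∘ₗ diff₂ k N = 0 := by
  refine IdemModule.hom_ext (fun _ ↦ (arrowSystem k N).isIdempotentElem_pairIdem _ _) fun i ↦ ?_
  change (arrowSystem k N).diff₁ k (diff₂ k N (gen₂ k i)) = 0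
  rw [diff₂_gen₂, map_relationValue, relationValue, loopValue_diff₁]
  simp only [Function.comp_apply, diff₁_gen₁_up, diff₁_gen₁_down, smul_sub, ten_smul_ten_smul,
    mul_one, one_mul, down_mul_up]
  abel

/-- The generators of `P₁` define a derivation to the cokernel of `diff₂`, and the projection to
this cokernel vanishes on every cycle because it comes from a derivation. -/
lemma exact_diff₂_diff₁ : Function.Exact (diff₂ k N) ((arrowSystem k N).diff₁ k) := fun u ↦ by
  refine ⟨fun hu ↦ ?_, ?_⟩
  · let π := (LinearMap.range (diff₂ k N)).mkQ
    let _ : Module k (_ ⧸ LinearMap.range (diff₂ k N)) :=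
      Module.compHom _ (algebraMap k (Env k (PathAlg k N)))
    have : IsScalarTower k (Env k (PathAlg k N)) (_ ⧸ LinearMap.range (diff₂ k N)) :=
      .of_algebraMap_smul fun _ _ ↦ rfl
    obtain ⟨D, hD, hDπ⟩ := exists_derivation (d := π ∘ (arrowSystem k N).gen₁ k)
      (fun α ↦ by rw [Function.comp_apply, ← map_smul, ArrowSystem.pairIdem_smul_gen₁])
      (fun i ↦ by
        rw [← map_relationValue, ← diff₂_gen₂]
        exact (Submodule.Quotient.mk_eq_zero _).2 ⟨_, rfl⟩)
    exact (Submodule.Quotient.mk_eq_zero _).1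
      ((arrowSystem k N).map_eq_zero_of_diff₁_eq_zero hD (f := π) hDπ hu)
  · rintro ⟨v, rfl⟩
    exact LinearMap.congr_fun (diff₁_comp_diff₂ k) v

lemma coeff_diff₂ (u : P₂ k N) (α : Arrow N) :
    IdemModule.coeff (diff₂ k N u) α = ∑ i, IdemModule.coeff u i *
      relationValue k (fun β ↦ IdemModule.coeff ((arrowSystem k N).gen₁ k β) α) i := by
  have h (i) := map_relationValue (d := (arrowSystem k N).gen₁ k)
    (LinearMap.proj α ∘ₗ IdemModule.coeff) i
  simp only [LinearMap.comp_apply, LinearMap.proj_apply] at h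
  simp only [diff₂, IdemModule.lift_apply, map_sum, map_smul, Finset.sum_apply, Pi.smul_apply,
    smul_eq_mul, h]
  rfl

lemma coeff_gen₁_self (α : Arrow N) : IdemModule.coeff ((arrowSystem k N).gen₁ k α) α =
    (arrowSystem k N).pairIdem k ((arrowSystem k N).tgt α) ((arrowSystem k N).src α) :=
  IdemModule.coeff_gen_self _ α

variable {k} in
lemma coeff_gen₁_of_ne {α β : Arrow N} (h : β ≠ α) :
    IdemModule.coeff ((arrowSystem k N).gen₁ k β) α = 0 :=
  IdemModule.coeff_gen_of_ne _ h.symm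

lemma coeff_diff₂_loop₀ {n : ℕ} (u : P₂ k (n + 1)) :
    IdemModule.coeff (diff₂ k (n + 1) u) .loop₀ = -IdemModule.coeff u 0 := by
  have hu : IdemModule.coeff u 0 * (arrowSystem k (n + 1)).pairIdem k 0 0 = IdemModule.coeff u 0 :=
    IdemModule.coeff_mul u 0
  have hloop : IdemModule.coeff ((arrowSystem k (n + 1)).gen₁ k .loop₀) .loop₀ =
      (arrowSystem k (n + 1)).pairIdem k 0 0 :=
    coeff_gen₁_self k .loop₀
  rw [coeff_diff₂, Fintype.sum_eq_single 0]
  · simp [relationValue, loopValue, coeff_gen₁_of_ne, hloop, hu]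
  · intro i hi
    obtain ⟨j, rfl⟩ := Fin.exists_succ_eq.2 hi
    rw [relationValue, ← Fin.succ_castSucc]
    simp [loopValue, coeff_gen₁_of_ne]

variable {k} in
lemma loopValue_coeff_gen₁_up_of_ne {i : Fin (N + 1)} {j : Fin N} (h : i ≠ j.succ) :
    loopValue k (fun β ↦ IdemModule.coeff ((arrowSystem k N).gen₁ k β) (.up j)) i = 0 := by
  cases i using Fin.cases with
  | zero => exact coeff_gen₁_of_ne nofun
  | succ l =>
    have hlj : l ≠ j := fun h' ↦ h (congrArg Fin.succ h')
    simp [loopValue, coeff_gen₁_of_ne, hlj]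

lemma ten_smul_coeff_gen₁_up_self (j : Fin N) :
    ten k 1 (down k j) • IdemModule.coeff ((arrowSystem k N).gen₁ k (.up j)) (.up j) =
      ten k (idem k j.succ) (down k j) := by
  rw [coeff_gen₁_self, smul_eq_mul, ArrowSystem.pairIdem, ten_mul_ten, one_mul]
  exact congrArg (ten k _) (idem_mul_down k j)

lemma coeff_diff₂_up {n : ℕ} (u : P₂ k (n + 1)) (j : Fin n) :
    IdemModule.coeff (diff₂ k (n + 1) u) (.up j.castSucc) =
      IdemModule.coeff u j.castSucc * ten k (down k j.castSucc) 1 *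
          IdemModule.coeff ((arrowSystem k (n + 1)).gen₁ k (.up j.castSucc)) (.up j.castSucc) -
        IdemModule.coeff u j.succ * ten k (idem k j.castSucc.succ) (down k j.castSucc) := by
  rw [coeff_diff₂, Fintype.sum_eq_add j.castSucc j.succ j.castSucc_lt_succ.ne, sub_eq_add_neg,
    ← mul_neg, mul_assoc]
  · congr 2
    · rw [relationValue, loopValue_coeff_gen₁_up_of_ne j.castSucc.castSucc_lt_succ.ne]
      simp [coeff_gen₁_of_ne]
    · rw [relationValue, ← Fin.succ_castSucc, loopValue, Fin.cases_succ,
        ten_smul_coeff_gen₁_up_self]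
      simp [coeff_gen₁_of_ne, j.castSucc_lt_succ.ne']
  · rintro i ⟨hi, hi'⟩
    rw [relationValue, loopValue_coeff_gen₁_up_of_ne fun h ↦ hi' (Fin.castSucc_injective _ h)]
    simp [coeff_gen₁_of_ne, hi]

lemma diff₂_injective : Function.Injective (diff₂ k N) := by
  rcases N with _ | n
  · exact fun u v _ ↦ IdemModule.ext fun i ↦ i.elim0
  refine (injective_iff_map_eq_zero _).2 fun u hu ↦ IdemModule.ext fun i ↦ ?_
  rw [map_zero, Pi.zero_apply]
  induction i using Fin.induction with
  | zero => simpa [hu] using coeff_diff₂_loop₀ k u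
  | succ j ih =>
    have h := coeff_diff₂_up k u j
    rw [hu, ih, map_zero, Pi.zero_apply, zero_mul, zero_mul, zero_sub, eq_comm, neg_eq_zero] at h
    refine mul_ten_one_injective (ctr_mul_injective k) ?_
    have hctr : IdemModule.coeff u j.succ * ten k 1 (ctr k (n + 1)) = IdemModule.coeff u j.succ *
        ten k (idem k j.castSucc.succ) (down k j.castSucc) * ten k 1 (up k j.castSucc) := by
      nth_rw 1 [← IdemModule.coeff_mul u j.succ]
      rw [mul_assoc, mul_assoc, ArrowSystem.pairIdem, ten_mul_ten, ten_mul_ten, up_mul_down,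
        mul_one, mul_one]
      exact congrArg (fun a ↦ IdemModule.coeff u j.succ * ten k _ a) (ctr_mul_idem k _)
    simp only [hctr, h, zero_mul]

variable (N) in
/-- The resolution of the diagonal bimodule by vertices, arrows and relations. -/
def resolution : ShortResolution (Env k (PathAlg k N)) (PathAlg k N) ((arrowSystem k N).P₀ k)
    ((arrowSystem k N).P₁ k) (P₂ k N) where
  ε := (arrowSystem k N).augmentation k
  d₁ := (arrowSystem k N).diff₁ k
  d₂ := diff₂ k N
  ε_surjective := (arrowSystem k N).augmentation_surjective k
  exact_d₁_ε := (arrowSystem k N).exact_diff₁_augmentation (generates_arrowSystem k)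
  exact_d₂_d₁ := exact_diff₂_diff₁ k
  d₂_injective := diff₂_injective k

end Resolution

end KLRW

namespace KLRW

open Polynomial

variable (k : Type u) [Field k] {N : ℕ}

section Cochain

/-- The component of the algebra at a pair of vertices is free of rank one over the polynomials in
the central element, with the shortest path as a basis. -/
def componentEquiv (i j : Fin (N + 1)) :
    k[X] ≃ₗ[k] fixedSubmodule k ((arrowSystem k N).pairIdem k i j) (PathAlg k N) :=
  LinearEquiv.ofBijective
    ((LinearMap.mulRight k (path k i j) ∘ₗ (aeval (ctr k N)).toLinearMap).codRestrict _ fun f ↦ by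
      change ten k (idem k i) (idem k j) • (ev k N f * path k i j) = ev k N f * path k i j
      rw [ten_smul, ← mul_assoc, ← (ev_commute f _).eq, mul_assoc, mul_assoc, path_mul_idem,
        idem_mul_path])
    ⟨(injective_iff_map_eq_zero _).2 fun f hf ↦
        eq_zero_of_rep_ev_mul_path_eq_zero (i := i) (j := j) <|
          (congrArg (rep k N) (congrArg Subtype.val hf)).trans (map_zero _),
      fun ⟨a, ha⟩ ↦ (exists_component a i j).imp fun f hf ↦
        Subtype.ext (hf.symm.trans ((ten_smul _ _ a).symm.trans ha))⟩

section

variable {ι : Type*} [Fintype ι] (t s : ι → Fin (N + 1))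

/-- Families of polynomials as homomorphisms to the diagonal bimodule, where a polynomial stands for
a multiple of the shortest path. -/
def cochainEquiv : (ι → k[X]) ≃ₗ[k]
    (IdemModule (fun α ↦ (arrowSystem k N).pairIdem k (t α) (s α)) →ₗ[Env k (PathAlg k N)]
      PathAlg k N) :=
  (LinearEquiv.piCongrRight fun α ↦ componentEquiv k (t α) (s α)).trans
    (IdemModule.homEquiv k (fun _ ↦ (arrowSystem k N).isIdempotentElem_pairIdem _ _) _)

lemma cochainEquiv_gen (c : ι → k[X]) (α : ι) :
    cochainEquiv k t s c
      (IdemModule.gen (fun _ ↦ (arrowSystem k N).isIdempotentElem_pairIdem _ _) α) =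
        ev k N (c α) * path k (t α) (s α) :=
  IdemModule.homEquiv_apply_gen ..

end

variable (N) in
/-- The differential on cochains of degree zero. -/
def codiff₀ : (Fin (N + 1) → k[X]) →ₗ[k] Arrow N → k[X] :=
  LinearMap.funLeft k k[X] (arrowSystem k N).src - LinearMap.funLeft k k[X] (arrowSystem k N).tgt

lemma codiff₀_apply (g : Fin (N + 1) → k[X]) (α : Arrow N) :
    codiff₀ k N g α = g ((arrowSystem k N).src α) - g ((arrowSystem k N).tgt α) := rfl

/-- The coefficient at the loop of the vertex `i` of the derivation with given coefficients at the
arrows. -/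
def loopCoeff : Fin (N + 1) → (Arrow N → k[X]) →ₗ[k] k[X] :=
  Fin.cases (LinearMap.proj .loop₀) fun j ↦
    LinearMap.mulRight k X ∘ₗ (LinearMap.proj (.up j) + LinearMap.proj (.down j))

variable {k} in
lemma loopCoeff_zero (c : Arrow N → k[X]) : loopCoeff k 0 c = c .loop₀ := rfl

variable {k} in
lemma loopCoeff_succ (c : Arrow N → k[X]) (j : Fin N) :
    loopCoeff k j.succ c = (c (.up j) + c (.down j)) * X := rfl

variable (N) in
/-- The differential on cochains of degree one. -/
def codiff₁ : (Arrow N → k[X]) →ₗ[k] Fin N → k[X] :=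
  LinearMap.pi fun i ↦ loopCoeff k i.succ - loopCoeff k i.castSucc

variable {k} in
lemma codiff₁_apply (c : Arrow N → k[X]) (i : Fin N) :
    codiff₁ k N c i = loopCoeff k i.succ c - loopCoeff k i.castSucc c := rfl

lemma ev_mul_loop (f : k[X]) (i : Fin (N + 1)) :
    ev k N f * loop k i = ev k N (f * X) * idem k i := by
  rw [← ctr_mul_idem, ← mul_assoc, ev, ev, map_mul, aeval_X]

lemma ten_smul_ev_mul (a b x : PathAlg k N) (f : k[X]) :
    ten k a b • (ev k N f * x) = ev k N f * (a * x * b) := by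
  rw [ten_smul, ← mul_assoc, ← (ev_commute f a).eq, mul_assoc, mul_assoc, mul_assoc]

lemma cochainEquiv_codiff₀ (g : Fin (N + 1) → k[X]) :
    cochainEquiv k (arrowSystem k N).tgt (arrowSystem k N).src (codiff₀ k N g) =
      cochainEquiv k id id g ∘ₗ (arrowSystem k N).diff₁ k := by
  refine (arrowSystem k N).hom_ext₁ k fun α ↦ ?_
  have hgen (i) : cochainEquiv k id id g ((arrowSystem k N).gen₀ k i) = ev k N (g i) * idem k i :=
    (cochainEquiv_gen k id id g i).trans (congrArg _ (path_self k i))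
  rw [LinearMap.comp_apply, ArrowSystem.diff₁_gen₁, map_sub, map_smul, map_smul, hgen, hgen,
    ten_smul_ev_mul, ten_smul_ev_mul, mul_one, one_mul, ArrowSystem.gen₁, cochainEquiv_gen,
    codiff₀_apply, ev, map_sub, sub_mul]
  cases α with
  | loop₀ => exact (sub_self _).trans (by simp [arrowSystem])
  | up i => simp [arrowSystem]
  | down i => simp [arrowSystem]

section

variable (c : Arrow N → k[X])

lemma loopValue_cochain (i : Fin (N + 1)) :
    loopValue k (fun α ↦ ev k N (c α) * path k ((arrowSystem k N).tgt α) ((arrowSystem k N).src α))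
      i = ev k N (loopCoeff k i c) * idem k i := by
  cases i using Fin.cases with
  | zero => exact congrArg (ev k N (c .loop₀) * ·) (path_self k 0)
  | succ j =>
    simp only [loopValue, Fin.cases_succ, ten_smul_ev_mul, arrowSystem, path_succ_castSucc,
      path_castSucc_succ, mul_one, one_mul, up_mul_down, ev_mul_loop, loopCoeff_succ]
    rw [← add_mul, ← map_add, add_comm, add_mul]

lemma cochainEquiv_codiff₁ :
    cochainEquiv k Fin.castSucc Fin.castSucc (codiff₁ k N c) =
      cochainEquiv k (arrowSystem k N).tgt (arrowSystem k N).src c ∘ₗ diff₂ k N := by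
  refine IdemModule.hom_ext (fun _ ↦ (arrowSystem k N).isIdempotentElem_pairIdem _ _) fun i ↦ ?_
  have hgen : cochainEquiv k (arrowSystem k N).tgt (arrowSystem k N).src c ∘
      (arrowSystem k N).gen₁ k =
        fun α ↦ ev k N (c α) * path k ((arrowSystem k N).tgt α) ((arrowSystem k N).src α) :=
    funext fun α ↦ cochainEquiv_gen ..
  rw [cochainEquiv_gen, LinearMap.comp_apply]
  change _ = cochainEquiv k _ _ c (diff₂ k N (gen₂ k i))
  rw [diff₂_gen₂, map_relationValue, hgen, relationValue, loopValue_cochain]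
  simp only [ten_smul_ev_mul, arrowSystem, path_succ_castSucc, path_castSucc_succ, mul_one, one_mul,
    down_mul_up, ev_mul_loop, path_self, codiff₁_apply, loopCoeff_succ]
  rw [← add_mul, ← map_add, ← add_mul, ev, map_sub, sub_mul]

end

instance : Module.Projective (Env k (PathAlg k N)) ((arrowSystem k N).P₀ k) :=
  IdemModule.projective fun _ ↦ (arrowSystem k N).isIdempotentElem_pairIdem _ _

instance : Module.Projective (Env k (PathAlg k N)) ((arrowSystem k N).P₁ k) :=
  IdemModule.projective fun _ ↦ (arrowSystem k N).isIdempotentElem_pairIdem _ _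

instance : Module.Projective (Env k (PathAlg k N)) (P₂ k N) :=
  IdemModule.projective fun _ ↦ (arrowSystem k N).isIdempotentElem_pairIdem _ _

variable (N) in
/-- The complex of families of polynomials that computes the Hochschild cohomology. -/
def cochainModel : CochainModel k (resolution k N) (PathAlg k N) (Fin (N + 1) → k[X])
    (Arrow N → k[X]) (Fin N → k[X]) where
  δ₀ := codiff₀ k N
  δ₁ := codiff₁ k N
  equiv₀ := cochainEquiv k id id
  equiv₁ := cochainEquiv k (arrowSystem k N).tgt (arrowSystem k N).src
  equiv₂ := cochainEquiv k Fin.castSucc Fin.castSucc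
  equiv₁_δ₀ := cochainEquiv_codiff₀ k
  equiv₂_δ₁ := cochainEquiv_codiff₁ k

end Cochain

end KLRW

namespace KLRW

open Polynomial

variable (k : Type u) [Field k] {N : ℕ}

section Cohomology

lemma mem_ker_codiff₀ {g : Fin (N + 1) → k[X]} :
    g ∈ LinearMap.ker (codiff₀ k N) ↔ ∀ i, g i = g 0 := by
  refine ⟨fun h i ↦ ?_, fun h ↦ funext fun α ↦ ?_⟩
  · induction i using Fin.induction with
    | zero => rfl
    | succ i ih => exact (sub_eq_zero.1 (congrFun h (.up i))).symm.trans ih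
  · rw [codiff₀_apply, h, h ((arrowSystem k N).tgt α), sub_self, Pi.zero_apply]

variable (N) in
/-- The constant families of polynomials as the cocycles of degree zero. -/
def cocycleZeroEquiv : k[X] ≃ₗ[k] LinearMap.ker (codiff₀ k N) :=
  LinearEquiv.ofBijective
    ((LinearMap.pi fun _ ↦ LinearMap.id).codRestrict _ fun _ ↦ (mem_ker_codiff₀ k).2 fun _ ↦ rfl)
    ⟨fun _ _ h ↦ congrFun (congrArg Subtype.val h) 0,
      fun g ↦ ⟨g.1 0, Subtype.ext (funext fun i ↦ ((mem_ker_codiff₀ k).1 g.2 i).symm)⟩⟩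

variable {k}

lemma mem_range_codiff₀ {c : Arrow N → k[X]} :
    c ∈ LinearMap.range (codiff₀ k N) ↔ c .loop₀ = 0 ∧ ∀ i, c (.up i) + c (.down i) = 0 := by
  constructor
  · rintro ⟨g, rfl⟩
    exact ⟨sub_self _, fun i ↦ sub_add_sub_cancel' .. |>.trans (sub_self _)⟩
  · rintro ⟨hloop, hc⟩
    refine ⟨Fin.partialSum fun i ↦ c (.down i), funext fun α ↦ ?_⟩
    cases α with
    | loop₀ => rw [hloop]; exact sub_self _
    | up i =>
      simp [codiff₀_apply, arrowSystem, Fin.partialSum_succ, eq_neg_of_add_eq_zero_left (hc i)]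
    | down i => simp [codiff₀_apply, arrowSystem, Fin.partialSum_succ]

lemma mem_ker_codiff₁ {c : Arrow N → k[X]} :
    c ∈ LinearMap.ker (codiff₁ k N) ↔ ∀ i, loopCoeff k i c = c .loop₀ := by
  refine ⟨fun h i ↦ ?_, fun h ↦ funext fun i ↦ ?_⟩
  · induction i using Fin.induction with
    | zero => rfl
    | succ i ih => exact (sub_eq_zero.1 (congrFun h i)).trans ih
  · rw [codiff₁_apply, h, h, sub_self, Pi.zero_apply]

lemma mem_range_codiff₀_of_mem_ker {c : Arrow N → k[X]} (hc : c ∈ LinearMap.ker (codiff₁ k N))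
    (hloop : c .loop₀ = 0) : c ∈ LinearMap.range (codiff₀ k N) :=
  mem_range_codiff₀.2 ⟨hloop, fun i ↦ (mul_eq_zero_iff_right X_ne_zero).1 <|
    ((loopCoeff_succ c i).symm.trans (mem_ker_codiff₁.1 hc i.succ)).trans hloop⟩

variable (k N) in
/-- The multiples by polynomials in the central element of the derivation that fixes the loops and
the arrows to the right and kills the arrows to the left. When there are no arrows, the derivation
with value `1` at the loop takes its place. -/
def eulerCocycle : k[X] →ₗ[k] LinearMap.ker (codiff₁ k N) :=
  (LinearMap.pi fun
    | .loop₀ => LinearMap.mulRight k (if N = 0 then 1 else X)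
    | .up _ => LinearMap.id
    | .down _ => 0).codRestrict _ fun f ↦ mem_ker_codiff₁.2 fun i ↦ by
      cases i using Fin.cases with
      | zero => rfl
      | succ j => simp [loopCoeff_succ, j.pos.ne']

lemma eulerCocycle_loop₀ (f : k[X]) :
    (eulerCocycle k N f).1 .loop₀ = f * if N = 0 then 1 else X := rfl

lemma exists_eulerCocycle_loop₀_eq {c : Arrow N → k[X]} (hc : c ∈ LinearMap.ker (codiff₁ k N)) :
    ∃ f, (eulerCocycle k N f).1 .loop₀ = c .loop₀ := by
  rcases N with _ | n
  · exact ⟨c .loop₀, mul_one _⟩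
  · exact ⟨c (.up 0) + c (.down 0), mem_ker_codiff₁.1 hc (Fin.succ 0)⟩

variable (k N) in
/-- The classes of the multiples of the Euler derivation as the first cohomology. -/
def cohomologyOneEquiv : k[X] ≃ₗ[k] LinearMap.ker (codiff₁ k N) ⧸
    (LinearMap.range (codiff₀ k N)).submoduleOf (LinearMap.ker (codiff₁ k N)) :=
  LinearEquiv.ofBijective (Submodule.mkQ _ ∘ₗ eulerCocycle k N)
    ⟨(injective_iff_map_eq_zero _).2 fun f hf ↦ by
      have hmem : (eulerCocycle k N f).1 ∈ LinearMap.range (codiff₀ k N) :=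
        (Submodule.Quotient.mk_eq_zero ((LinearMap.range (codiff₀ k N)).submoduleOf _)).1 hf
      have hloop := (mem_range_codiff₀.1 hmem).1
      rw [eulerCocycle_loop₀] at hloop
      refine (mul_eq_zero_iff_right ?_).1 hloop
      split_ifs
      exacts [one_ne_zero, X_ne_zero],
    (Submodule.mkQ_surjective _).forall.2 fun c ↦
      (exists_eulerCocycle_loop₀_eq c.2).imp fun f hf ↦ (Submodule.Quotient.eq _).2 <|
        mem_range_codiff₀_of_mem_ker (sub_mem (eulerCocycle k N f).2 c.2) (sub_eq_zero.2 hf)⟩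

variable (k) in
/-- The constant coefficients at all relations but the first. -/
def constCoeffs (n : ℕ) : (Fin (n + 1) → k[X]) →ₗ[k] Fin n → k :=
  LinearMap.pi fun j ↦ lcoeff k 0 ∘ₗ LinearMap.proj j.succ

lemma constCoeffs_apply {n : ℕ} (h : Fin (n + 1) → k[X]) (j : Fin n) :
    constCoeffs k n h j = (h j.succ).coeff 0 := rfl

lemma constCoeffs_surjective (n : ℕ) : Function.Surjective (constCoeffs k n) := fun v ↦
  ⟨Fin.cons 0 fun j ↦ C (v j), funext fun j ↦ by simp [constCoeffs_apply]⟩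

lemma codiff₁_succ {n : ℕ} (c : Arrow (n + 1) → k[X]) (j : Fin n) :
    codiff₁ k (n + 1) c j.succ = (c (.up j.succ) + c (.down j.succ) -
      (c (.up j.castSucc) + c (.down j.castSucc))) * X := by
  rw [codiff₁_apply, ← Fin.succ_castSucc, loopCoeff_succ, loopCoeff_succ, sub_mul]

lemma ker_constCoeffs (n : ℕ) :
    LinearMap.ker (constCoeffs k n) = LinearMap.range (codiff₁ k (n + 1)) := by
  refine le_antisymm (fun h hh ↦ ?_) ?_
  · let c : Arrow (n + 1) → k[X] := fun
      | .loop₀ => -h 0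
      | .up i => Fin.partialSum (fun j ↦ (h j.succ).divX) i
      | .down _ => 0
    refine ⟨c, funext fun i ↦ ?_⟩
    cases i using Fin.cases with
    | zero =>
      rw [codiff₁_apply, loopCoeff_succ, Fin.castSucc_zero, loopCoeff_zero]
      simp [c]
    | succ j =>
      have hj : (h j.succ).coeff 0 = 0 := congrFun hh j
      rw [codiff₁_succ, ← divX_mul_X_add (h j.succ), hj]
      simp [c, Fin.partialSum_succ]
  · rintro _ ⟨c, rfl⟩
    exact funext fun j ↦ by rw [constCoeffs_apply, codiff₁_succ, coeff_mul_X_zero, Pi.zero_apply]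

variable (k) in
/-- The second cohomology by the constant coefficients at all relations but the first. -/
def cohomologyTwoEquiv (n : ℕ) :
    ((Fin (n + 1) → k[X]) ⧸ LinearMap.range (codiff₁ k (n + 1))) ≃ₗ[k] (Fin n → k) :=
  (Submodule.quotEquivOfEq _ _ (ker_constCoeffs n).symm).trans
    ((constCoeffs k n).quotKerEquivOfSurjective (constCoeffs_surjective n))

end Cohomology

end KLRW

end

theorem mainTheorem1 (k : Type u) [Field k] (N : ℕ) :
    Nonempty (HochschildCohomology k (KLRW.Alg k N) 0 ≃ₗ[k] (ℕ →₀ k)) ∧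
    Nonempty (HochschildCohomology k (KLRW.Alg k N) 1 ≃ₗ[k] (ℕ →₀ k)) ∧
    (1 ≤ N → Nonempty (HochschildCohomology k (KLRW.Alg k N) 2 ≃ₗ[k] (Fin (N - 1) → k))) ∧
    (∀ n : ℕ, 3 ≤ n → Subsingleton (HochschildCohomology k (KLRW.Alg k N) n)) := by
  refine ⟨⟨(KLRW.cochainModel k N).extZeroEquiv.trans
      ((KLRW.cocycleZeroEquiv k N).symm.trans (Polynomial.basisMonomials k).repr)⟩,
    ⟨(KLRW.cochainModel k N).extOneEquiv.trans
      ((KLRW.cohomologyOneEquiv k N).symm.trans (Polynomial.basisMonomials k).repr)⟩, fun h ↦ ?_,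
    fun n ↦ (KLRW.resolution k N).subsingleton_ext _⟩
  obtain ⟨n, rfl⟩ := Nat.exists_eq_add_of_le' h
  exact ⟨(KLRW.cochainModel k (n + 1)).extTwoEquiv.trans (KLRW.cohomologyTwoEquiv k n)⟩
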